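/- Conventions. For a unital C$^*$-algebra $M$ put $\mathbb H_+(M)=\{T\in M : \operatorname{Im}T\ge \varepsilon 1 \text{ for some }\varepsilon>0\}$, where $\operatorname{Im}T=(T-T^*)/2i$, and let $M_n(M)$ be the C$^*$-algebra of $n\times n$ matrices over $M$. Let $K$ be a unital C$^*$-algebra, $1\in A\subset K$ a C$^*$-subalgebra and $X\in K$. Write $A\langle X\rangle$ for the (algebraic) subalgebra of $K$ generated by $A$ and $X$. The element $X$ is algebraically free from $A$ if the evaluation $P\mapsto P(X)$ from the ring $A\langle t\rangle$ of noncommutative polynomials with coefficients in $A$ (the free product of $A$ and $\mathbb C[t]$ over $\mathbb C$) to $K$ is injective. In that case the free difference quotient $\partial_{X:A}:A\langle X\rangle\to A\langle X\rangle\otimes A\langle X\rangle$ (algebraic tensor product over $\mathbb C$) is the unique derivation, for the bimodule structure $p\cdot(x\otimes y)\cdot q=px\otimes yq$, with $\partial_{X:A}(a)=0$ for $a\in A$ and $\partial_{X:A}(X)=1\otimes 1$. It is called closable if, as an unbounded operator from $K$ to the minimal (spatial) C$^*$-tensor product $K\otimes_{\min} K$ with domain $A\langle X\rangle$, the closure of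 its graph (for the norms of $K$ and $K\otimes_{\min}K$) is a graph. Theorem. Let $K$ and $L$ be unital C$^*$-algebras, and $1\in A\subset K$, $1\in B\subset L$ C$^*$-subalgebras. Let $X=X^*\in K$ be algebraically free from $A$ and $Y=Y^*\in L$ algebraically free from $B$. Suppose $\Psi:L\to K$ is a unital completely positive linear map such that $\Psi(B\langle Y\rangle)\subset A\langle X\rangle$ and $$(\Psi\otimes\Psi)\circ\partial_{Y:B}=\partial_{X:A}\circ\Psi|_{B\langle Y\rangle}.$$ Suppose also that $\partial_{X:A}$ and $\partial_{Y:B}$ are closable. Then for every $n$ there is a holomorphic map $F_n:\mathbb H_+(M_n(B))\to\mathbb H_+(M_n(A))$ such that for every $\beta\in\mathbb H_+(M_n(B))$ the matrices $Y\otimes I_n-\beta$ and $X\otimes I_n-F_n(\beta)$ are invertible in $M_n(L)$ and $M_n(K)$ respectively, and $$M_n(\Psi)\big((Y\otimes I_n-\beta)^{-1}\big)=\big(X\otimes I_n-F_n(\beta)\big)^{-1},$$ where $M_n(\Psi)$ is $\Psi$ applied entrywise. -/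

import Mathlib

open scoped TensorProduct CStarAlgebra ComplexStarModule

universe u v

/-! ## Noncommutative polynomials `A⟨t⟩` over a complex algebra `A` -/

/-- The relations that make `a ↦ ι (some a)` a homomorphism of unital complex algebras. -/
inductive NCPolynomial.Rel (A : Type u) [Ring A] [Algebra ℂ A] :
    FreeAlgebra ℂ (Option A) → FreeAlgebra ℂ (Option A) → Prop
  | add (a b : A) : Rel A (FreeAlgebra.ι ℂ (some (a + b)))
      (FreeAlgebra.ι ℂ (some a) + FreeAlgebra.ι ℂ (some b))
  | mul (a b : A) : Rel A (FreeAlgebra.ι ℂ (some (a * b)))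
      (FreeAlgebra.ι ℂ (some a) * FreeAlgebra.ι ℂ (some b))
  | scalar (r : ℂ) : Rel A (FreeAlgebra.ι ℂ (some (algebraMap ℂ A r))) (algebraMap ℂ _ r)

/-- `A⟨t⟩`, the ring of polynomials in an indeterminate `t` that does not commute with the
coefficients; it is the free product (over `ℂ`, with amalgamated units) of `A` and `ℂ[t]`.
In the presentation, `ι (some a)` stands for the coefficient `a` and `ι none` for `t`. -/
abbrev NCPolynomial (A : Type u) [Ring A] [Algebra ℂ A] : Type u :=
  RingQuot (NCPolynomial.Rel A)

namespace NCPolynomial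

variable {A : Type u} [Ring A] [Algebra ℂ A] {S : Type v} [Ring S] [Algebra ℂ S]

/-- The indeterminate. -/
noncomputable def var (A : Type u) [Ring A] [Algebra ℂ A] : NCPolynomial A :=
  RingQuot.mkAlgHom ℂ (Rel A) (FreeAlgebra.ι ℂ none)

/-- A coefficient as a constant polynomial. -/
noncomputable def const (a : A) : NCPolynomial A :=
  RingQuot.mkAlgHom ℂ (Rel A) (FreeAlgebra.ι ℂ (some a))

/-- The homomorphism out of `A⟨t⟩` that is `f` on the coefficients and sends `t` to `s`. -/
noncomputable def lift (f : A →ₐ[ℂ] S) (s : S) : NCPolynomial A →ₐ[ℂ] S :=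
  RingQuot.liftAlgHom ℂ
    ⟨FreeAlgebra.lift ℂ (fun o : Option A => o.elim s f), by
      intro x y h
      induction h <;> simp⟩

@[simp]
theorem lift_const (f : A →ₐ[ℂ] S) (s : S) (a : A) : lift f s (const a) = f a := by
  simp [lift, const]

@[simp]
theorem lift_var (f : A →ₐ[ℂ] S) (s : S) : lift f s (var A) = s := by
  simp [lift, var]

theorem adjoin_eq_top :
    Algebra.adjoin ℂ (Set.range (const (A := A)) ∪ {var A}) = ⊤ := by
  have h := congrArg (Subalgebra.map (RingQuot.mkAlgHom ℂ (Rel A)))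
    (FreeAlgebra.adjoin_range_ι ℂ (Option A))
  rw [AlgHom.map_adjoin, Algebra.map_top,
    (AlgHom.range_eq_top _).2 (RingQuot.mkAlgHom_surjective ℂ (Rel A))] at h
  rw [← h]
  congr 1
  ext p
  constructor
  · rintro (⟨a, rfl⟩ | rfl)
    · exact ⟨_, ⟨some a, rfl⟩, rfl⟩
    · exact ⟨_, ⟨none, rfl⟩, rfl⟩
  · rintro ⟨_, ⟨o, rfl⟩, rfl⟩
    cases o with
    | none => exact Or.inr rfl
    | some a => exact Or.inl ⟨a, rfl⟩

end NCPolynomial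

/-! ## The free difference quotient -/

section FreeDifferenceQuotient

variable {K : Type u} [CStarAlgebra K]

/-- `A⟨X⟩`, the (not closed) subalgebra of `K` generated by `A` and `X`. -/
def polyAlgebra (A : StarSubalgebra ℂ K) (X : K) : Subalgebra ℂ K :=
  Algebra.adjoin ℂ ((A : Set K) ∪ {X})

/-- Evaluation `A⟨t⟩ → K`, `P ↦ P(X)`. -/
noncomputable def polyEval (A : StarSubalgebra ℂ K) (X : K) : NCPolynomial A →ₐ[ℂ] K :=
  NCPolynomial.lift A.toSubalgebra.val X

/-- `X` is algebraically free from `A`: no nonzero polynomial in `A⟨t⟩` vanishes at `X`. -/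
def AlgebraicallyFree (A : StarSubalgebra ℂ K) (X : K) : Prop :=
  Function.Injective (polyEval A X)

theorem polyEval_range (A : StarSubalgebra ℂ K) (X : K) :
    (polyEval A X).range = polyAlgebra A X := by
  rw [← Algebra.map_top, ← NCPolynomial.adjoin_eq_top, AlgHom.map_adjoin, polyAlgebra]
  congr 1
  ext x
  constructor
  · rintro ⟨_, ⟨a, rfl⟩ | rfl, rfl⟩
    · left; simp [polyEval]
    · right; simp [polyEval]
  · rintro (hx | rfl)
    · exact ⟨_, Or.inl ⟨⟨x, hx⟩, rfl⟩, by simp [polyEval]⟩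
    · exact ⟨_, Or.inr rfl, by simp [polyEval]⟩

/-- If `X` is algebraically free from `A`, evaluation is an isomorphism `A⟨t⟩ ≃ A⟨X⟩`. -/
noncomputable def polyEquiv {A : StarSubalgebra ℂ K} {X : K} (h : AlgebraicallyFree A X) :
    NCPolynomial A ≃ₐ[ℂ] polyAlgebra A X :=
  (AlgEquiv.ofInjective (polyEval A X) h).trans
    (Subalgebra.equivOfEq _ _ (polyEval_range A X))

/-- `A` as a subalgebra of `A⟨X⟩`. -/
def polyCoeff (A : StarSubalgebra ℂ K) (X : K) : A →ₐ[ℂ] polyAlgebra A X :=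
  Subalgebra.inclusion (S := A.toSubalgebra)
    (fun _ hx => Algebra.subset_adjoin (Or.inl hx))

/-- `X` as an element of `A⟨X⟩`. -/
def polyGen (A : StarSubalgebra ℂ K) (X : K) : polyAlgebra A X :=
  ⟨X, Algebra.subset_adjoin (Or.inr rfl)⟩

/-- For any algebra `S`, the homomorphism `s ↦ diag (s ⊗ 1, 1 ⊗ s)` into `M₂(S ⊗ S)`. -/
noncomputable def diagTensor (S : Type u) [Ring S] [Algebra ℂ S] :
    S →ₐ[ℂ] Matrix (Fin 2) (Fin 2) (S ⊗[ℂ] S) :=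
  (Matrix.diagonalAlgHom ℂ).comp
    (AlgHom.pi (A := fun _ : Fin 2 => S ⊗[ℂ] S)
      ![Algebra.TensorProduct.includeLeft, Algebra.TensorProduct.includeRight])

/-- The homomorphism `A⟨t⟩ → M₂(A⟨X⟩ ⊗ A⟨X⟩)`,
`P ↦ !![P(X) ⊗ 1, (∂P)(X); 0, 1 ⊗ P(X)]`, which encodes the Leibniz rule for `∂`. -/
noncomputable def fdqHom (A : StarSubalgebra ℂ K) (X : K) :
    NCPolynomial A →ₐ[ℂ]
      Matrix (Fin 2) (Fin 2) (polyAlgebra A X ⊗[ℂ] polyAlgebra A X) :=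
  NCPolynomial.lift ((diagTensor (polyAlgebra A X)).comp (polyCoeff A X))
    (diagTensor (polyAlgebra A X) (polyGen A X) + Matrix.single 0 1 1)

/-- The free difference quotient `∂_{X:A} : A⟨X⟩ → A⟨X⟩ ⊗ A⟨X⟩` (algebraic tensor product), the
derivation with `∂ a = 0` for `a ∈ A` and `∂ X = 1 ⊗ 1`. -/
noncomputable def freeDifferenceQuotient {A : StarSubalgebra ℂ K} {X : K}
    (h : AlgebraicallyFree A X) :
    polyAlgebra A X →ₗ[ℂ] polyAlgebra A X ⊗[ℂ] polyAlgebra A X :=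
  (Matrix.entryLinearMap ℂ (polyAlgebra A X ⊗[ℂ] polyAlgebra A X) 0 1) ∘ₗ
    (fdqHom A X).toLinearMap ∘ₗ (polyEquiv h).symm.toLinearMap

/-- The free difference quotient with its values read in `K ⊗ K`. -/
noncomputable def freeDifferenceQuotientIn {A : StarSubalgebra ℂ K} {X : K}
    (h : AlgebraicallyFree A X) : polyAlgebra A X →ₗ[ℂ] K ⊗[ℂ] K :=
  TensorProduct.map (polyAlgebra A X).val.toLinearMap (polyAlgebra A X).val.toLinearMap ∘ₗ
    freeDifferenceQuotient h

theorem polyEquiv_const {A : StarSubalgebra ℂ K} {X : K} (h : AlgebraicallyFree A X) (a : A) :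
    polyEquiv h (NCPolynomial.const a) = polyCoeff A X a := by
  apply Subtype.ext
  change polyEval A X _ = _
  rw [polyEval, NCPolynomial.lift_const]
  rfl

theorem polyEquiv_var {A : StarSubalgebra ℂ K} {X : K} (h : AlgebraicallyFree A X) :
    polyEquiv h (NCPolynomial.var A) = polyGen A X := by
  apply Subtype.ext
  change polyEval A X _ = _
  simp [polyEval, polyGen]

theorem freeDifferenceQuotient_coeff {A : StarSubalgebra ℂ K} {X : K}
    (h : AlgebraicallyFree A X) (a : A) :
    freeDifferenceQuotient h (polyCoeff A X a) = 0 := by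
  simp [freeDifferenceQuotient, ← polyEquiv_const h, fdqHom, diagTensor]

theorem freeDifferenceQuotient_gen {A : StarSubalgebra ℂ K} {X : K}
    (h : AlgebraicallyFree A X) :
    freeDifferenceQuotient h (polyGen A X) = 1 ⊗ₜ 1 := by
  simp [freeDifferenceQuotient, ← polyEquiv_var h, fdqHom, diagTensor,
    Algebra.TensorProduct.one_def]

theorem fdqHom_entries {A : StarSubalgebra ℂ K} {X : K}
    (h : AlgebraicallyFree A X) (P : NCPolynomial A) :
    fdqHom A X P 0 0 = polyEquiv h P ⊗ₜ 1 ∧ fdqHom A X P 1 1 = 1 ⊗ₜ polyEquiv h P ∧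
      fdqHom A X P 1 0 = 0 := by
  have hP : P ∈ Algebra.adjoin ℂ
      (Set.range (NCPolynomial.const (A := A)) ∪ {NCPolynomial.var A}) := by
    rw [NCPolynomial.adjoin_eq_top]; trivial
  induction hP using Algebra.adjoin_induction with
  | mem x hx =>
    rcases hx with ⟨a, rfl⟩ | rfl
    · simp [fdqHom, diagTensor, polyEquiv_const]
    · simp [fdqHom, diagTensor, polyEquiv_var]
  | algebraMap r =>
    simp [Algebra.algebraMap_eq_smul_one, Algebra.TensorProduct.one_def,
      TensorProduct.smul_tmul']
  | add x y _ _ hx hy =>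
    simp [hx, hy, TensorProduct.add_tmul, TensorProduct.tmul_add]
  | mul x y _ _ hx hy =>
    simp [Matrix.mul_apply, hx, hy]

/-- The Leibniz rule. -/
theorem freeDifferenceQuotient_mul {A : StarSubalgebra ℂ K} {X : K}
    (h : AlgebraicallyFree A X) (p q : polyAlgebra A X) :
    freeDifferenceQuotient h (p * q) =
      (p ⊗ₜ 1) * freeDifferenceQuotient h q + freeDifferenceQuotient h p * (1 ⊗ₜ q) := by
  simp [freeDifferenceQuotient, Matrix.mul_apply, fdqHom_entries h]

end FreeDifferenceQuotient

/-! ## The minimal C⋆-tensor product -/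

section MinTensor

variable {K L : Type u} [CStarAlgebra K] [CStarAlgebra L]

/-- For representations `π₁`, `π₂` of `K`, `L` on Hilbert spaces `H₁`, `H₂`, the representation
`π₁ ⊗ π₂` of the algebraic tensor product `K ⊗ L` on the pre-Hilbert space `H₁ ⊗ H₂`. Passing to
the completion of `H₁ ⊗ H₂` changes no operator norm. -/
noncomputable def tensorRep {H₁ H₂ : Type u}
    [NormedAddCommGroup H₁] [InnerProductSpace ℂ H₁] [CompleteSpace H₁]
    [NormedAddCommGroup H₂] [InnerProductSpace ℂ H₂] [CompleteSpace H₂]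
    (π₁ : K →⋆ₐ[ℂ] (H₁ →L[ℂ] H₁)) (π₂ : L →⋆ₐ[ℂ] (H₂ →L[ℂ] H₂)) :
    K ⊗[ℂ] L →ₗ[ℂ] ((H₁ ⊗[ℂ] H₂) →L[ℂ] (H₁ ⊗[ℂ] H₂)) :=
  TensorProduct.lift
    (LinearMap.mk₂ ℂ (fun a b => TensorProduct.mapL (π₁ a) (π₂ b))
      (fun a a' b => by simp [TensorProduct.mapL_add_left])
      (fun c a b => by simp [TensorProduct.mapL_smul_left])
      (fun a b b' => by simp [TensorProduct.mapL_add_right])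
      (fun c a b => by simp [TensorProduct.mapL_smul_right]))

/-- The norms `‖(π₁ ⊗ π₂)(z)‖`, for all representations `π₁`, `π₂` on Hilbert spaces. -/
def minNormSet (z : K ⊗[ℂ] L) : Set ℝ :=
  {r | ∃ (H₁ H₂ : Type u)
    (_ : NormedAddCommGroup H₁) (_ : InnerProductSpace ℂ H₁) (_ : CompleteSpace H₁)
    (_ : NormedAddCommGroup H₂) (_ : InnerProductSpace ℂ H₂) (_ : CompleteSpace H₂)
    (π₁ : K →⋆ₐ[ℂ] (H₁ →L[ℂ] H₁)) (π₂ : L →⋆ₐ[ℂ] (H₂ →L[ℂ] H₂)),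
    r = ‖tensorRep π₁ π₂ z‖}

theorem minNormSet_nonempty (z : K ⊗[ℂ] L) : (minNormSet z).Nonempty := by
  have h1 : ∀ x y : (PUnit.{u+1} →L[ℂ] PUnit.{u+1}), x = y := fun x y => by ext
  refine ⟨_, PUnit, PUnit, inferInstance, inferInstance, inferInstance, inferInstance,
    inferInstance, inferInstance, ?_, ?_, rfl⟩
  · exact
      { toFun := fun _ => 0, map_one' := h1 _ _, map_mul' := fun _ _ => h1 _ _,
        map_zero' := rfl, map_add' := fun _ _ => h1 _ _, commutes' := fun _ => h1 _ _,
        map_star' := fun _ => h1 _ _ }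
  · exact
      { toFun := fun _ => 0, map_one' := h1 _ _, map_mul' := fun _ _ => h1 _ _,
        map_zero' := rfl, map_add' := fun _ _ => h1 _ _, commutes' := fun _ => h1 _ _,
        map_star' := fun _ => h1 _ _ }

theorem norm_tensorRep_mem {H₁ H₂ : Type u}
    [NormedAddCommGroup H₁] [InnerProductSpace ℂ H₁] [CompleteSpace H₁]
    [NormedAddCommGroup H₂] [InnerProductSpace ℂ H₂] [CompleteSpace H₂]
    (π₁ : K →⋆ₐ[ℂ] (H₁ →L[ℂ] H₁)) (π₂ : L →⋆ₐ[ℂ] (H₂ →L[ℂ] H₂)) (z : K ⊗[ℂ] L) :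
    ‖tensorRep π₁ π₂ z‖ ∈ minNormSet z :=
  ⟨H₁, H₂, _, _, ‹_›, _, _, ‹_›, π₁, π₂, rfl⟩

theorem forall_mem_minNormSet {z : K ⊗[ℂ] L} {p : ℝ → Prop}
    (h : ∀ (H₁ H₂ : Type u)
      [NormedAddCommGroup H₁] [InnerProductSpace ℂ H₁] [CompleteSpace H₁]
      [NormedAddCommGroup H₂] [InnerProductSpace ℂ H₂] [CompleteSpace H₂]
      (π₁ : K →⋆ₐ[ℂ] (H₁ →L[ℂ] H₁)) (π₂ : L →⋆ₐ[ℂ] (H₂ →L[ℂ] H₂)),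
      p ‖tensorRep π₁ π₂ z‖) : ∀ r ∈ minNormSet z, p r := by
  rintro r ⟨H₁, H₂, _, _, _, _, _, _, π₁, π₂, rfl⟩
  exact h H₁ H₂ π₁ π₂

theorem minNormSet_bddAbove (z : K ⊗[ℂ] L) : BddAbove (minNormSet z) := by
  induction z using TensorProduct.induction_on with
  | zero =>
    refine ⟨0, forall_mem_minNormSet ?_⟩
    intro H₁ H₂ _ _ _ _ _ _ π₁ π₂
    rw [map_zero]
    exact ContinuousLinearMap.opNorm_zero.le
  | tmul a b =>
    refine ⟨‖a‖ * ‖b‖, forall_mem_minNormSet ?_⟩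
    intro H₁ H₂ _ _ _ _ _ _ π₁ π₂
    have h : tensorRep π₁ π₂ (a ⊗ₜ[ℂ] b) = TensorProduct.mapL (π₁ a) (π₂ b) := by
      simp [tensorRep]
    rw [h]
    exact (TensorProduct.norm_mapL_le _ _).trans
      (mul_le_mul (NonUnitalStarAlgHom.norm_apply_le π₁ a) (NonUnitalStarAlgHom.norm_apply_le π₂ b)
        (norm_nonneg _) (norm_nonneg _))
  | add x y hx hy =>
    obtain ⟨c, hc⟩ := hx
    obtain ⟨d, hd⟩ := hy
    refine ⟨c + d, forall_mem_minNormSet ?_⟩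
    intro H₁ H₂ _ _ _ _ _ _ π₁ π₂
    rw [map_add]
    exact (ContinuousLinearMap.opNorm_add_le _ _).trans (add_le_add (hc (norm_tensorRep_mem π₁ π₂ x))
      (hd (norm_tensorRep_mem π₁ π₂ y)))

/-- The minimal (spatial) C⋆-norm on the algebraic tensor product,
`‖z‖ = sup ‖(π₁ ⊗ π₂)(z)‖` over all representations `π₁` of `K` and `π₂` of `L`. -/
noncomputable def minTensorSeminorm (K L : Type u) [CStarAlgebra K] [CStarAlgebra L] :
    Seminorm ℂ (K ⊗[ℂ] L) :=
  Seminorm.ofSMulLE (fun z => sSup (minNormSet z))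
    (by
      refine le_antisymm (csSup_le (minNormSet_nonempty _) (forall_mem_minNormSet ?_))
        (Real.sSup_nonneg (forall_mem_minNormSet ?_))
      · intro H₁ H₂ _ _ _ _ _ _ π₁ π₂
        rw [map_zero]
        exact ContinuousLinearMap.opNorm_zero.le
      · intro H₁ H₂ _ _ _ _ _ _ π₁ π₂
        exact ContinuousLinearMap.opNorm_nonneg _)
    (by
      intro x y
      refine csSup_le (minNormSet_nonempty _) (forall_mem_minNormSet ?_)
      intro H₁ H₂ _ _ _ _ _ _ π₁ π₂
      rw [map_add]
      exact (ContinuousLinearMap.opNorm_add_le _ _).trans (add_le_add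
        (le_csSup (minNormSet_bddAbove x) (norm_tensorRep_mem π₁ π₂ x))
        (le_csSup (minNormSet_bddAbove y) (norm_tensorRep_mem π₁ π₂ y))))
    (by
      intro c x
      refine csSup_le (minNormSet_nonempty _) (forall_mem_minNormSet ?_)
      intro H₁ H₂ _ _ _ _ _ _ π₁ π₂
      rw [map_smul]
      exact (ContinuousLinearMap.opNorm_smul_le _ _).trans (mul_le_mul_of_nonneg_left
        (le_csSup (minNormSet_bddAbove x) (norm_tensorRep_mem π₁ π₂ x)) (norm_nonneg _)))

/-- The algebraic tensor product, carrying the minimal C⋆-norm. -/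
def PreMinTensor (K L : Type u) [CStarAlgebra K] [CStarAlgebra L] : Type u := K ⊗[ℂ] L

noncomputable instance : AddCommGroup (PreMinTensor K L) :=
  inferInstanceAs (AddCommGroup (K ⊗[ℂ] L))

noncomputable instance : Module ℂ (PreMinTensor K L) :=
  inferInstanceAs (Module ℂ (K ⊗[ℂ] L))

noncomputable instance : SeminormedAddCommGroup (PreMinTensor K L) :=
  AddGroupSeminorm.toSeminormedAddCommGroup (E := PreMinTensor K L)
    (minTensorSeminorm K L).toAddGroupSeminorm

noncomputable instance : NormedSpace ℂ (PreMinTensor K L) where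
  norm_smul_le c z := (map_smul_eq_mul (minTensorSeminorm K L) c z).le

/-- The minimal (spatial) tensor product `K ⊗_min L`, as a Banach space. -/
abbrev MinTensor (K L : Type u) [CStarAlgebra K] [CStarAlgebra L] : Type u :=
  UniformSpace.Completion (PreMinTensor K L)

/-- The canonical map of the algebraic tensor product into `K ⊗_min L`. -/
noncomputable def toMinTensor (K L : Type u) [CStarAlgebra K] [CStarAlgebra L] :
    K ⊗[ℂ] L →ₗ[ℂ] MinTensor K L :=
  (UniformSpace.Completion.toComplₗᵢ (𝕜 := ℂ) (E := PreMinTensor K L)).toLinearMap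

end MinTensor

/-- `∂_{X:A}` as a partially defined operator `K → K ⊗_min K` with domain `A⟨X⟩`. -/
noncomputable def freeDifferenceQuotientOp {K : Type u} [CStarAlgebra K]
    {A : StarSubalgebra ℂ K} {X : K} (h : AlgebraicallyFree A X) : K →ₗ.[ℂ] MinTensor K K where
  domain := Subalgebra.toSubmodule (polyAlgebra A X)
  toFun := toMinTensor K K ∘ₗ freeDifferenceQuotientIn h

/-! ## Half-planes and matrices -/

/-- The order of a C⋆-algebra, restricted to a C⋆-subalgebra, is the order of the subalgebra. -/
instance StarSubalgebra.starOrderedRingOfIsClosed {K : Type u} [CStarAlgebra K] [PartialOrder K]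
    [StarOrderedRing K] (A : StarSubalgebra ℂ K) [IsClosed (A : Set K)] : StarOrderedRing A := by
  refine StarOrderedRing.of_nonneg_iff' (fun {x y} hxy z => ?_) (fun x => ⟨fun hx => ?_, ?_⟩)
  · exact add_le_add_right (α := K) hxy (z : K)
  · have hx' : (0 : K) ≤ x := hx
    have hmem : CFC.sqrt (x : K) ∈ A := by
      rw [CFC.sqrt_eq_real_sqrt _ hx']
      exact cfcₙ_mem (𝕜' := ℂ) Real.sqrt x.2
    refine ⟨⟨CFC.sqrt (x : K), hmem⟩, Subtype.ext ?_⟩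
    change (x : K) = star (CFC.sqrt (x : K)) * CFC.sqrt (x : K)
    rw [(CFC.sqrt_nonneg (x : K)).isSelfAdjoint.star_eq, CFC.sqrt_mul_sqrt_self _ hx']
  · rintro ⟨s, rfl⟩
    exact star_mul_self_nonneg (s : K)

/-- The upper half-plane `{T : Im T ≥ ε 1 for some ε > 0}` of a unital C⋆-algebra. -/
def upperHalfPlane (M : Type u) [CStarAlgebra M] [PartialOrder M] : Set M :=
  {T | ∃ ε : ℝ, 0 < ε ∧ algebraMap ℂ M (ε : ℂ) ≤ (ℑ T : M)}

/-- `T ⊗ I_n`, the `n × n` matrix with `T` on the diagonal. -/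
def tensorOne {K : Type u} [CStarAlgebra K] (T : K) (n : ℕ) : CStarMatrix (Fin n) (Fin n) K :=
  CStarMatrix.ofMatrix (Matrix.diagonal fun _ => T)

/-! ## Half-planes of C⋆-algebras -/

section UpperHalfPlane

variable {M N : Type*} [CStarAlgebra M] [CStarAlgebra N]

/-! The formula leaves no choice: with `G(β) = M_n(Ψ)((Y - β)⁻¹)`, one must take `F(β) = X -
G(β)⁻¹`. Half-plane arguments make this meaningful in `M_n(K)`: `Y - β` has strictly negative
imaginary part, so its inverse lies in the upper half-plane, a unital positive map keeps it there,
and `T ↦ -T⁻¹` preserves the half-plane. Subtracting selfadjoint elements changes no imaginary part.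
The real content is that `F(β)` has its entries in `A`.

The kernel of `∂_{X:A}` is exactly `A` (`freeDifferenceQuotientIn_eq_zero_iff`), so the aim is to
show that `∂` kills `X - G(β)⁻¹`. Heuristically, the Leibniz rule gives `∂(Y - β)⁻¹ = -(Y - β)⁻¹ ⊗
(Y - β)⁻¹`; the intertwining relation carries this to `∂G = -G ⊗ G`, and Leibniz again gives `∂(G⁻¹)
= 1 ⊗ 1 = ∂X`.

Resolvents need not lie in `B⟨Y⟩`, so the computation is made on formal power series. The inverse of
`tY - β` in the variable `t` has coefficients over `B⟨Y⟩`, because `β` is invertible over `B`; its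
image under `Ψ` has constant term `Ψ(-β⁻¹)`, invertible over `A`. The argument above, with `∂`
sending `tY - β` to `t`, shows that every coefficient of `tX - V` lies over `A`, where `V` is the
formal inverse of the image (`coeff_linear_sub_inverse_mem`).

For real `z`, `zY` is selfadjoint, so `z ↦ zX - M_n(Ψ)((zY - β)⁻¹)⁻¹` is analytic on the whole line.
Near `0` it is the sum of that series, hence has entries in the closed subspace `A`; the identity
theorem in the quotient by `A` extends this to `z = 1` (`apply_sub_inverse_mem_of_coeff_mem`). -/

theorem algebraMap_complex_ofReal (r : ℝ) : algebraMap ℂ M (r : ℂ) = algebraMap ℝ M r := by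
  simp [Algebra.algebraMap_eq_smul_one]

theorem IsSelfAdjoint.isUnit_add_I {h : M} (hh : IsSelfAdjoint h) :
    IsUnit (h + algebraMap ℂ M Complex.I) := by
  have hI : -Complex.I ∉ spectrum ℂ h := fun hmem => by
    simpa using hh.im_eq_zero_of_mem_spectrum hmem
  rw [spectrum.notMem_iff] at hI
  have := hI.neg
  rwa [map_neg, neg_sub, sub_neg_eq_add] at this

/-- From `T⁻¹ (T - T*) T⁻¹* = T⁻¹* - T⁻¹`. Being a congruence of `Im T`, the right side inherits
positivity. -/
theorem imaginaryPart_neg_inv (T : Mˣ) :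
    (ℑ (-(↑T⁻¹ : M)) : M) = (↑T⁻¹ : M) * (ℑ (T : M) : M) * star (↑T⁻¹ : M) := by
  have h1 : (T : M) - star (T : M) = (2 * Complex.I) • (ℑ (T : M) : M) := by
    rw [imaginaryPart_apply_coe, ← Complex.coe_smul, smul_smul, smul_smul]
    have : 2 * Complex.I * (-Complex.I * ((2⁻¹ : ℝ) : ℂ)) = 1 := by
      push_cast
      linear_combination -Complex.I_mul_I
    rw [← mul_assoc] at this
    simp only [mul_assoc] at this ⊢
    rw [this, one_smul]
  have h2 : -(↑T⁻¹ : M) - star (-(↑T⁻¹ : M)) =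
      (↑T⁻¹ : M) * ((T : M) - star (T : M)) * star (↑T⁻¹ : M) := by
    have h3 : star (T : M) * star (↑T⁻¹ : M) = 1 := by rw [← star_mul]; simp
    rw [mul_sub, sub_mul, mul_assoc _ (star (T : M)), h3]
    simp [sub_eq_add_neg, add_comm]
  rw [imaginaryPart_apply_coe (-(↑T⁻¹ : M)), h2, imaginaryPart_apply_coe (T : M)]
  simp only [mul_smul_comm, smul_mul_assoc]

theorem sub_mem_upperHalfPlane [PartialOrder M] {T a : M} (hT : T ∈ upperHalfPlane M) (ha : IsSelfAdjoint a) :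
    T - a ∈ upperHalfPlane M := by
  obtain ⟨ε, hε, hle⟩ := hT
  refine ⟨ε, hε, ?_⟩
  rwa [map_sub, imaginaryPart_eq_zero_iff.2 ha, sub_zero]

theorem mem_upperHalfPlane_iff [PartialOrder M] {T : M} :
    T ∈ upperHalfPlane M ↔ ∃ ε : ℝ, 0 < ε ∧ algebraMap ℝ M ε ≤ (ℑ T : M) := by
  simp only [upperHalfPlane, algebraMap_complex_ofReal, Set.mem_ofPred_eq]

variable [PartialOrder M] [StarOrderedRing M] [PartialOrder N] [StarOrderedRing N]

/-- An element with strictly positive imaginary part is invertible. -/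
theorem isUnit_of_mem_upperHalfPlane {T : M} (hT : T ∈ upperHalfPlane M) : IsUnit T := by
  obtain ⟨ε, hε, hle⟩ := mem_upperHalfPlane_iff.1 hT
  have hb0 : (0 : M) ≤ (ℑ T : M) := (algebraMap_nonneg M hε.le).trans hle
  have hbu : IsUnit (ℑ T : M) :=
    CStarAlgebra.isUnit_of_le _ hle
      (IsStrictlyPositive.iff_of_unital.2
        ⟨algebraMap_nonneg M hε.le, (isUnit_iff_ne_zero.2 hε.ne').map (algebraMap ℝ M)⟩)
  -- With `c² = Im T`, factor `T = c (c⁻¹ (Re T) c⁻¹ + i) c`; a selfadjoint element plus `i` is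
  -- invertible.
  set c : M := CFC.sqrt (ℑ T : M) with hc
  have hcc : c * c = (ℑ T : M) := CFC.sqrt_mul_sqrt_self _ hb0
  have hcs : IsSelfAdjoint c := (CFC.sqrt_nonneg (ℑ T : M)).isSelfAdjoint
  have hcu : IsUnit c := ((Commute.refl c).isUnit_mul_iff.1 (hcc ▸ hbu)).1
  obtain ⟨d, hd⟩ := hcu
  have hds : star (↑d⁻¹ : M) = ↑d⁻¹ := by
    have h1 : star (d : M) = d := hd ▸ hcs.star_eq
    have h2 : star d = d := Units.ext h1
    rw [← Units.coe_star, star_inv, h2]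
  have hh : IsSelfAdjoint ((↑d⁻¹ : M) * (ℜ T : M) * ↑d⁻¹) := by
    have : star (ℜ T : M) = (ℜ T : M) := (ℜ T).2
    simp only [IsSelfAdjoint, star_mul, hds, this, mul_assoc]
  have key : T = d * ((↑d⁻¹ : M) * (ℜ T : M) * ↑d⁻¹ + algebraMap ℂ M Complex.I) * d := by
    conv_lhs => rw [← realPart_add_I_smul_imaginaryPart T, ← hcc, ← hd]
    simp [mul_add, add_mul, mul_assoc, Algebra.algebraMap_eq_smul_one]
  rw [key]
  exact (d.isUnit.mul hh.isUnit_add_I).mul d.isUnit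

/-- The half-plane is stable under `T ↦ -T⁻¹`. -/
theorem neg_inverse_mem_upperHalfPlane {T : M} (hT : T ∈ upperHalfPlane M) :
    -Ring.inverse T ∈ upperHalfPlane M := by
  obtain ⟨T, rfl⟩ := isUnit_of_mem_upperHalfPlane hT
  obtain ⟨ε, hε, hle⟩ := mem_upperHalfPlane_iff.1 hT
  rw [Ring.inverse_unit, mem_upperHalfPlane_iff, imaginaryPart_neg_inv]
  have hpos : 0 < ‖(T : M)‖ ^ 2 + 1 := by positivity
  -- Conjugating `T T* ≤ ‖T‖² + 1` by `T⁻¹` bounds `T⁻¹ T⁻¹*` below. The `+ 1` keeps the constant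
  -- positive even in the zero algebra (`n = 0`).
  refine ⟨(‖(T : M)‖ ^ 2 + 1)⁻¹ * ε, by positivity, ?_⟩
  have h1 : (1 : M) ≤ (‖(T : M)‖ ^ 2 + 1) • ((↑T⁻¹ : M) * star (↑T⁻¹ : M)) := by
    have h2 : (T : M) * star (T : M) ≤ algebraMap ℝ M (‖(T : M)‖ ^ 2 + 1) :=
      CStarAlgebra.mul_star_le_algebraMap_norm_sq.trans
        (algebraMap_mono M (by linarith))
    have h3 := star_right_conjugate_le_conjugate h2 (↑T⁻¹ : M)
    have h4 : star (T : M) * star (↑T⁻¹ : M) = 1 := by rw [← star_mul]; simp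
    have h5 : (↑T⁻¹ : M) * ((T : M) * star (T : M)) * star (↑T⁻¹ : M) = 1 := by
      rw [mul_assoc, mul_assoc, h4]; simp
    rw [h5] at h3
    simpa [Algebra.algebraMap_eq_smul_one] using h3
  have h6 := star_right_conjugate_le_conjugate hle (↑T⁻¹ : M)
  refine le_trans ?_ h6
  have h7 := smul_le_smul_of_nonneg_left h1
    (show (0 : ℝ) ≤ (‖(T : M)‖ ^ 2 + 1)⁻¹ * ε by positivity)
  have h8 : (‖(T : M)‖ ^ 2 + 1)⁻¹ * ε * (‖(T : M)‖ ^ 2 + 1) = ε := by field_simp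
  rw [smul_smul, h8] at h7
  simpa [Algebra.algebraMap_eq_smul_one] using h7

theorem isOpen_upperHalfPlane : IsOpen (upperHalfPlane M) := by
  rw [Metric.isOpen_iff]
  intro T hT
  obtain ⟨ε, hε, hle⟩ := mem_upperHalfPlane_iff.1 hT
  refine ⟨ε / 2, by positivity, fun S hS => mem_upperHalfPlane_iff.2 ⟨ε / 2, by positivity, ?_⟩⟩
  have h1 : ‖(ℑ (S - T) : M)‖ ≤ ε / 2 := by
    have := imaginaryPart.norm_le (S - T)
    rw [Metric.mem_ball, dist_eq_norm] at hS
    exact this.trans hS.le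
  have h2 : -algebraMap ℝ M (ε / 2) ≤ (ℑ (S - T) : M) :=
    (neg_le_neg (algebraMap_mono M h1)).trans
      (IsSelfAdjoint.neg_algebraMap_norm_le_self (ℑ (S - T)).2)
  have h3 : (ℑ S : M) = (ℑ T : M) + (ℑ (S - T) : M) := by simp
  rw [h3]
  refine le_trans (le_of_eq ?_) (add_le_add hle h2)
  rw [← map_neg, ← map_add]
  congr 1
  ring

/-- A unital positive map sends half-plane to half-plane. -/
theorem map_mem_upperHalfPlane {F : Type*} [FunLike F M N] [LinearMapClass F ℂ M N]
    [OrderHomClass F M N] (φ : F) (hφ : φ 1 = 1) {T : M} (hT : T ∈ upperHalfPlane M) :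
    φ T ∈ upperHalfPlane N := by
  obtain ⟨ε, hε, hle⟩ := hT
  refine ⟨ε, hε, ?_⟩
  have := OrderHomClass.mono φ hle
  rwa [Algebra.algebraMap_eq_smul_one, map_smul, hφ, ← Algebra.algebraMap_eq_smul_one,
    map_imaginaryPart] at this

/-- Spectral permanence: an injective star homomorphism preserves the spectrum of a selfadjoint
element. This lets half-plane membership in `M_n(A)` be tested in `M_n(K)`. -/
theorem nonneg_of_map_nonneg {F : Type*} [FunLike F M N] [AlgHomClass F ℂ M N]
    [StarHomClass F M N] (φ : F) (hφ : Function.Injective φ) {a : M} (ha : 0 ≤ φ a) : 0 ≤ a := by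
  have hsa : IsSelfAdjoint a := by
    apply hφ
    rw [map_star]
    exact ha.isSelfAdjoint.star_eq
  rw [StarOrderedRing.nonneg_iff_spectrum_nonneg (R := ℝ) a, ← hsa.map_spectrum_real φ hφ]
  exact (StarOrderedRing.nonneg_iff_spectrum_nonneg (R := ℝ) (φ a)).1 ha

theorem mem_upperHalfPlane_of_map {F : Type*} [FunLike F M N] [AlgHomClass F ℂ M N]
    [StarHomClass F M N] (φ : F) (hφ : Function.Injective φ) {T : M}
    (hT : φ T ∈ upperHalfPlane N) : T ∈ upperHalfPlane M := by
  obtain ⟨ε, hε, hle⟩ := hT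
  refine ⟨ε, hε, ?_⟩
  rw [← sub_nonneg] at hle ⊢
  refine nonneg_of_map_nonneg φ hφ ?_
  rwa [map_sub, map_imaginaryPart, AlgHomClass.commutes]

end UpperHalfPlane

/-! ## The kernel of the free difference quotient -/

section Kernel

variable {K : Type u} [CStarAlgebra K] {A : StarSubalgebra ℂ K} {X : K}

/-- The homomorphism `A⟨X⟩ → A` that is the identity on `A` and kills `X`. -/
noncomputable def polyAugmentation (h : AlgebraicallyFree A X) : polyAlgebra A X →ₐ[ℂ] A :=
  (NCPolynomial.lift (AlgHom.id ℂ A) 0).comp (polyEquiv h).symm.toAlgHom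

theorem polyAugmentation_coeff (h : AlgebraicallyFree A X) (a : A) :
    polyAugmentation h (polyCoeff A X a) = a := by
  simp [polyAugmentation, ← polyEquiv_const h]

theorem polyAugmentation_gen (h : AlgebraicallyFree A X) :
    polyAugmentation h (polyGen A X) = 0 := by
  simp [polyAugmentation, ← polyEquiv_var h]

/-- `x ⊗ y ↦ x X ε(y)`, where `ε` is the augmentation. -/
noncomputable def polyContract (h : AlgebraicallyFree A X) :
    polyAlgebra A X ⊗[ℂ] polyAlgebra A X →ₗ[ℂ] polyAlgebra A X :=
  TensorProduct.lift ((LinearMap.mul ℂ (polyAlgebra A X)).compl₁₂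
    (LinearMap.mulRight ℂ (polyGen A X))
    ((polyCoeff A X).toLinearMap ∘ₗ (polyAugmentation h).toLinearMap))

theorem polyContract_tmul (h : AlgebraicallyFree A X) (x y : polyAlgebra A X) :
    polyContract h (x ⊗ₜ y) = x * polyGen A X * polyCoeff A X (polyAugmentation h y) := rfl

theorem polyContract_tmul_one_mul (h : AlgebraicallyFree A X) (p : polyAlgebra A X)
    (z : polyAlgebra A X ⊗[ℂ] polyAlgebra A X) :
    polyContract h ((p ⊗ₜ 1) * z) = p * polyContract h z := by
  induction z using TensorProduct.induction_on with
  | zero => simp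
  | tmul x y => simp [polyContract_tmul, mul_assoc]
  | add x y hx hy => simp [mul_add, hx, hy]

theorem polyContract_mul_one_tmul (h : AlgebraicallyFree A X) (q : polyAlgebra A X)
    (z : polyAlgebra A X ⊗[ℂ] polyAlgebra A X) :
    polyContract h (z * (1 ⊗ₜ q)) = polyContract h z * polyCoeff A X (polyAugmentation h q) := by
  induction z using TensorProduct.induction_on with
  | zero => simp
  | tmul x y => simp [polyContract_tmul, mul_assoc]
  | add x y hx hy => simp [add_mul, hx, hy]

/-- Both sides vanish on `A`, send `X` to `X`, and obey the same twisted Leibniz rule, since `pq -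
ε(pq) = p (q - ε(q)) + (p - ε(p)) ε(q)`. Thus `∂p` recovers `p` up to an element of `A`, which
identifies the kernel. -/
theorem polyContract_freeDifferenceQuotient (h : AlgebraicallyFree A X) (p : polyAlgebra A X) :
    polyContract h (freeDifferenceQuotient h p) = p - polyCoeff A X (polyAugmentation h p) := by
  obtain ⟨P, rfl⟩ := (polyEquiv h).surjective p
  have hP : P ∈ Algebra.adjoin ℂ
      (Set.range (NCPolynomial.const (A := A)) ∪ {NCPolynomial.var A}) := by
    rw [NCPolynomial.adjoin_eq_top]; trivial
  induction hP using Algebra.adjoin_induction with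
  | mem x hx =>
    rcases hx with ⟨a, rfl⟩ | rfl
    · rw [polyEquiv_const, freeDifferenceQuotient_coeff, polyAugmentation_coeff]
      simp
    · rw [polyEquiv_var, freeDifferenceQuotient_gen, polyAugmentation_gen, polyContract_tmul]
      simp
  | algebraMap r =>
    have hr : polyEquiv h (algebraMap ℂ _ r) = polyCoeff A X (algebraMap ℂ A r) := by simp
    rw [hr, freeDifferenceQuotient_coeff, polyAugmentation_coeff]
    simp
  | add x y _ _ hx hy =>
    simp only [map_add, hx, hy]
    abel
  | mul x y _ _ hx hy =>
    rw [map_mul, freeDifferenceQuotient_mul, map_add, polyContract_tmul_one_mul,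
      polyContract_mul_one_tmul, hx, hy, map_mul, map_mul]
    noncomm_ring

theorem freeDifferenceQuotientIn_eq_zero_iff (h : AlgebraicallyFree A X) (p : polyAlgebra A X) :
    freeDifferenceQuotientIn h p = 0 ↔ (p : K) ∈ A := by
  constructor
  · intro hp
    -- Over a field the inclusion `A⟨X⟩ ⊗ A⟨X⟩ → K ⊗ K` is injective, so reading `∂` in `K ⊗ K` does
    -- not enlarge its kernel.
    have hinj : Function.Injective (TensorProduct.map (polyAlgebra A X).val.toLinearMap
        (polyAlgebra A X).val.toLinearMap) :=
      TensorProduct.map_injective_of_flat_flat _ _ Subtype.val_injective Subtype.val_injective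
    have h0 : freeDifferenceQuotient h p = 0 :=
      hinj (by rw [map_zero]; exact hp)
    have h1 := polyContract_freeDifferenceQuotient h p
    rw [h0, map_zero, eq_comm, sub_eq_zero] at h1
    rw [h1]
    exact (polyAugmentation h p).2
  · intro hp
    have h1 : p = polyCoeff A X ⟨p, hp⟩ := rfl
    rw [h1, freeDifferenceQuotientIn, LinearMap.comp_apply, freeDifferenceQuotient_coeff, map_zero]

theorem freeDifferenceQuotientIn_gen (h : AlgebraicallyFree A X) :
    freeDifferenceQuotientIn h (polyGen A X) = 1 := by
  rw [freeDifferenceQuotientIn, LinearMap.comp_apply, freeDifferenceQuotient_gen]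
  rfl

theorem freeDifferenceQuotientIn_mul (h : AlgebraicallyFree A X) (p q : polyAlgebra A X) :
    freeDifferenceQuotientIn h (p * q) =
      ((p : K) ⊗ₜ 1) * freeDifferenceQuotientIn h q +
        freeDifferenceQuotientIn h p * (1 ⊗ₜ (q : K)) := by
  have hm : ∀ z : polyAlgebra A X ⊗[ℂ] polyAlgebra A X,
      TensorProduct.map (polyAlgebra A X).val.toLinearMap (polyAlgebra A X).val.toLinearMap z =
        Algebra.TensorProduct.map (polyAlgebra A X).val (polyAlgebra A X).val z := fun _ => rfl
  simp only [freeDifferenceQuotientIn, LinearMap.comp_apply, freeDifferenceQuotient_mul, hm,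
    map_add, map_mul, Algebra.TensorProduct.map_tmul, map_one, Subalgebra.coe_val]

end Kernel

/-! ## Twisted derivations on power series -/

namespace PowerSeries

variable {R T : Type*} [Ring R] [Ring T]

/-- Apply an additive map to every coefficient. -/
noncomputable def mapAdd (D : R →+ T) : PowerSeries R →+ PowerSeries T where
  toFun p := mk fun k => D (coeff k p)
  map_zero' := by ext; simp
  map_add' p q := by ext; simp

@[simp]
theorem coeff_mapAdd (D : R →+ T) (p : PowerSeries R) (k : ℕ) :
    coeff k (mapAdd D p) = D (coeff k p) := by
  simp [mapAdd]

theorem mapAdd_mul {D : R →+ T} {l r : R →+* T}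
    (hD : ∀ a b, D (a * b) = l a * D b + D a * r b) (p q : PowerSeries R) :
    mapAdd D (p * q) = map l p * mapAdd D q + mapAdd D p * map r q := by
  ext k
  simp [coeff_mul, hD, Finset.sum_add_distrib]

theorem mapAdd_one {D : R →+ T} {l r : R →+* T}
    (hD : ∀ a b, D (a * b) = l a * D b + D a * r b) : mapAdd D 1 = 0 := by
  have h := mapAdd_mul hD 1 1
  simpa using h

/-- If a twisted derivation sends `p` to `X`, it sends `q = p⁻¹` to `-X q q`. -/
theorem mapAdd_inverse_of_eq_X {D : R →+ T} {l r : R →+* T}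
    (hD : ∀ a b, D (a * b) = l a * D b + D a * r b) {p q : PowerSeries R}
    (hpq : p * q = 1) (hqp : q * p = 1) (hp : mapAdd D p = X) :
    mapAdd D q = -(X * (map l q * map r q)) := by
  have h := mapAdd_mul hD q p
  rw [hqp, mapAdd_one hD, hp] at h
  -- Now `0 = l(q) X + D(q) r(p)`; cancel `r(p)` on the right and use that the formal variable is
  -- central.
  have h2 := congrArg (· * map r q) h
  simp only [zero_mul, add_mul, mul_assoc, ← map_mul, hpq, map_one, mul_one] at h2
  rw [eq_comm, add_comm] at h2
  rw [eq_neg_of_add_eq_zero_left h2, ← mul_assoc, ← mul_assoc, (commute_X (map l q)).eq]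

/-- If a twisted derivation sends `p` to `-X p p`, it sends `q = p⁻¹` to `X`. -/
theorem mapAdd_inverse_eq_X {D : R →+ T} {l r : R →+* T}
    (hD : ∀ a b, D (a * b) = l a * D b + D a * r b) {p q : PowerSeries R}
    (hpq : p * q = 1) (hqp : q * p = 1) (hp : mapAdd D p = -(X * (map l p * map r p))) :
    mapAdd D q = X := by
  have h := mapAdd_mul hD p q
  rw [hpq, mapAdd_one hD, hp] at h
  -- Now `0 = l(p) D(q) - X l(p) r(p) r(q)`, and `r(p) r(q) = 1`; cancel `l(p)` on the left.
  have h2 := congrArg (map l q * ·) h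
  simp only [mul_zero, mul_add, neg_mul, mul_neg, mul_assoc, ← map_mul, hpq, map_one,
    mul_one] at h2
  rw [← (commute_X (map l p)).eq, ← mul_assoc, ← map_mul, hqp, ← mul_assoc, ← map_mul, hqp,
    map_one, one_mul, one_mul] at h2
  exact (sub_eq_zero.1 (by rw [sub_eq_add_neg]; exact h2.symm))

end PowerSeries

/-! ## Matrices over `A⟨X⟩` -/

section MatrixQuotient

variable {K : Type u} [CStarAlgebra K] {A : StarSubalgebra ℂ K} {X : K} (n : ℕ)

/-- `∂_{X:A}` applied entrywise. -/
noncomputable def matrixDifferenceQuotient (h : AlgebraicallyFree A X) :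
    Matrix (Fin n) (Fin n) (polyAlgebra A X) →+ Matrix (Fin n) (Fin n) (K ⊗[ℂ] K) :=
  (freeDifferenceQuotientIn h).toAddMonoidHom.mapMatrix

/-- `p ↦ p ⊗ 1`, applied entrywise. -/
noncomputable def matrixLeft (A : StarSubalgebra ℂ K) (X : K) :
    Matrix (Fin n) (Fin n) (polyAlgebra A X) →+* Matrix (Fin n) (Fin n) (K ⊗[ℂ] K) :=
  RingHom.mapMatrix (((Algebra.TensorProduct.includeLeft : K →ₐ[ℂ] K ⊗[ℂ] K).comp
    (polyAlgebra A X).val : polyAlgebra A X →ₐ[ℂ] K ⊗[ℂ] K) : polyAlgebra A X →+* K ⊗[ℂ] K)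

/-- `p ↦ 1 ⊗ p`, applied entrywise. -/
noncomputable def matrixRight (A : StarSubalgebra ℂ K) (X : K) :
    Matrix (Fin n) (Fin n) (polyAlgebra A X) →+* Matrix (Fin n) (Fin n) (K ⊗[ℂ] K) :=
  RingHom.mapMatrix (((Algebra.TensorProduct.includeRight : K →ₐ[ℂ] K ⊗[ℂ] K).comp
    (polyAlgebra A X).val : polyAlgebra A X →ₐ[ℂ] K ⊗[ℂ] K) : polyAlgebra A X →+* K ⊗[ℂ] K)

variable {n}

theorem matrixDifferenceQuotient_apply (h : AlgebraicallyFree A X)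
    (M : Matrix (Fin n) (Fin n) (polyAlgebra A X)) (i j : Fin n) :
    matrixDifferenceQuotient n h M i j = freeDifferenceQuotientIn h (M i j) := rfl

theorem matrixLeft_apply (M : Matrix (Fin n) (Fin n) (polyAlgebra A X)) (i j : Fin n) :
    matrixLeft n A X M i j = (M i j : K) ⊗ₜ 1 := rfl

theorem matrixRight_apply (M : Matrix (Fin n) (Fin n) (polyAlgebra A X)) (i j : Fin n) :
    matrixRight n A X M i j = 1 ⊗ₜ (M i j : K) := rfl

theorem matrixDifferenceQuotient_mul (h : AlgebraicallyFree A X)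
    (M N : Matrix (Fin n) (Fin n) (polyAlgebra A X)) :
    matrixDifferenceQuotient n h (M * N) = matrixLeft n A X M * matrixDifferenceQuotient n h N +
      matrixDifferenceQuotient n h M * matrixRight n A X N := by
  ext i j
  simp [Matrix.mul_apply, matrixDifferenceQuotient_apply, matrixLeft_apply, matrixRight_apply,
    freeDifferenceQuotientIn_mul, Finset.sum_add_distrib]

theorem matrixLeft_mul_matrixRight_apply (M N : Matrix (Fin n) (Fin n) (polyAlgebra A X))
    (i j : Fin n) :
    (matrixLeft n A X M * matrixRight n A X N) i j = ∑ k, (M i k : K) ⊗ₜ (N k j : K) := by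
  simp [Matrix.mul_apply, matrixLeft_apply, matrixRight_apply]

theorem matrixDifferenceQuotient_diagonal_gen (h : AlgebraicallyFree A X) :
    matrixDifferenceQuotient n h (Matrix.diagonal fun _ => polyGen A X) = 1 := by
  ext i j
  rw [matrixDifferenceQuotient_apply, Matrix.diagonal_apply, Matrix.one_apply]
  split_ifs <;> simp [freeDifferenceQuotientIn_gen]

theorem matrixDifferenceQuotient_eq_zero_iff (h : AlgebraicallyFree A X)
    (M : Matrix (Fin n) (Fin n) (polyAlgebra A X)) :
    matrixDifferenceQuotient n h M = 0 ↔ ∀ i j, (M i j : K) ∈ A := by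
  simp only [← Matrix.ext_iff, matrixDifferenceQuotient_apply, Matrix.zero_apply,
    freeDifferenceQuotientIn_eq_zero_iff]

open PowerSeries in
/-- The series `t X - M`, with formal parameter `t`, is sent to `t` when `M` has entries
in `A`. -/
theorem mapAdd_matrixDifferenceQuotient_linear (h : AlgebraicallyFree A X)
    {M : Matrix (Fin n) (Fin n) (polyAlgebra A X)} (hM : ∀ i j, (M i j : K) ∈ A) :
    mapAdd (matrixDifferenceQuotient n h)
      (PowerSeries.X * C (Matrix.diagonal fun _ => polyGen A X) - C M) = PowerSeries.X := by
  ext1 k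
  rw [coeff_mapAdd, map_sub, map_sub]
  match k with
  | 0 => simp [(matrixDifferenceQuotient_eq_zero_iff h M).2 hM]
  | 1 =>
    rw [coeff_succ_X_mul (n := 0)]
    simp [matrixDifferenceQuotient_diagonal_gen, coeff_C]
  | k + 2 =>
    rw [coeff_succ_X_mul]
    simp [coeff_X]

end MatrixQuotient

/-! ## Coalgebra morphisms and formal resolvents -/

section Formal

variable {K : Type u} {L : Type v} [CStarAlgebra K] [CStarAlgebra L]
  {A : StarSubalgebra ℂ K} {B : StarSubalgebra ℂ L} {X : K} {Y : L}

/-- The restriction `B⟨Y⟩ → A⟨X⟩` of a linear map, applied entrywise. -/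
noncomputable def matrixRestrict (n : ℕ) (Ψ : L →ₗ[ℂ] K)
    (hΨ : ∀ p ∈ polyAlgebra B Y, Ψ p ∈ polyAlgebra A X) :
    Matrix (Fin n) (Fin n) (polyAlgebra B Y) →+ Matrix (Fin n) (Fin n) (polyAlgebra A X) :=
  (Ψ.restrict (p := Subalgebra.toSubmodule (polyAlgebra B Y))
    (q := Subalgebra.toSubmodule (polyAlgebra A X)) hΨ).toAddMonoidHom.mapMatrix

theorem matrixRestrict_apply {n : ℕ} (Ψ : L →ₗ[ℂ] K)
    (hΨ : ∀ p ∈ polyAlgebra B Y, Ψ p ∈ polyAlgebra A X)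
    (M : Matrix (Fin n) (Fin n) (polyAlgebra B Y)) (i j : Fin n) :
    matrixRestrict n Ψ hΨ M i j = ⟨Ψ (M i j), hΨ _ (M i j).2⟩ := rfl

/-- A linear map intertwining the difference quotients sends `B` into `A`. -/
theorem map_coeff_mem (hXA : AlgebraicallyFree A X) (hYB : AlgebraicallyFree B Y)
    (Ψ : L →ₗ[ℂ] K) (hΨ : ∀ p ∈ polyAlgebra B Y, Ψ p ∈ polyAlgebra A X)
    (hcomul : ∀ p : polyAlgebra B Y, TensorProduct.map Ψ Ψ (freeDifferenceQuotientIn hYB p) =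
      freeDifferenceQuotientIn hXA ⟨Ψ p, hΨ p p.2⟩) {b : L} (hb : b ∈ B) : Ψ b ∈ A := by
  have h := hcomul (polyCoeff B Y ⟨b, hb⟩)
  rw [(freeDifferenceQuotientIn_eq_zero_iff hYB _).2 hb, map_zero, eq_comm,
    freeDifferenceQuotientIn_eq_zero_iff] at h
  exact h

open PowerSeries in
/-- If `W` is the formal resolvent `(t Y - β)⁻¹` with `β` over `B`, then the inverse of the
series `Ψ(W)` differs from `t X` by a series with coefficients over `A`. -/
theorem coeff_linear_sub_inverse_mem (hXA : AlgebraicallyFree A X) (hYB : AlgebraicallyFree B Y)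
    (Ψ : L →ₗ[ℂ] K) (hΨ : ∀ p ∈ polyAlgebra B Y, Ψ p ∈ polyAlgebra A X)
    (hcomul : ∀ p : polyAlgebra B Y, TensorProduct.map Ψ Ψ (freeDifferenceQuotientIn hYB p) =
      freeDifferenceQuotientIn hXA ⟨Ψ p, hΨ p p.2⟩) {n : ℕ}
    {β : Matrix (Fin n) (Fin n) (polyAlgebra B Y)} (hβ : ∀ i j, (β i j : L) ∈ B)
    {W : PowerSeries (Matrix (Fin n) (Fin n) (polyAlgebra B Y))}
    (hW₁ : (PowerSeries.X * C (Matrix.diagonal fun _ => polyGen B Y) - C β) * W = 1)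
    (hW₂ : W * (PowerSeries.X * C (Matrix.diagonal fun _ => polyGen B Y) - C β) = 1)
    {V : PowerSeries (Matrix (Fin n) (Fin n) (polyAlgebra A X))}
    (hV₁ : mapAdd (matrixRestrict n Ψ hΨ) W * V = 1)
    (hV₂ : V * mapAdd (matrixRestrict n Ψ hΨ) W = 1) (k : ℕ) (i j : Fin n) :
    ((coeff k (PowerSeries.X * C (Matrix.diagonal fun _ => polyGen A X) - V) :
      Matrix (Fin n) (Fin n) (polyAlgebra A X)) i j : K) ∈ A := by
  have hDW := mapAdd_inverse_of_eq_X (matrixDifferenceQuotient_mul hYB) hW₁ hW₂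
    (mapAdd_matrixDifferenceQuotient_linear hYB hβ)
  -- Multiplicativity of `Ψ` is not needed: the entries of `l(W) r(W)` are sums of elementary
  -- tensors, on which `Ψ ⊗ Ψ` acts factor by factor.
  have hD : mapAdd (matrixDifferenceQuotient n hXA) (mapAdd (matrixRestrict n Ψ hΨ) W) =
      -(PowerSeries.X * (map (matrixLeft n A X) (mapAdd (matrixRestrict n Ψ hΨ) W) *
        map (matrixRight n A X) (mapAdd (matrixRestrict n Ψ hΨ) W))) := by
    ext m a b
    have h1 := congrArg (fun p => TensorProduct.map Ψ Ψ
      ((coeff m p : Matrix (Fin n) (Fin n) (L ⊗[ℂ] L)) a b)) hDW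
    simp only [coeff_mapAdd, matrixDifferenceQuotient_apply] at h1 ⊢
    rw [matrixRestrict_apply, ← hcomul, h1]
    cases m with
    | zero => simp
    | succ m =>
      simp only [map_neg, coeff_succ_X_mul]
      simp only [map_neg, coeff_mul, Matrix.neg_apply, Matrix.sum_apply, map_sum,
        coeff_map, matrixLeft_mul_matrixRight_apply, TensorProduct.map_tmul, coeff_mapAdd,
        matrixRestrict_apply]
  have hV := mapAdd_inverse_eq_X (matrixDifferenceQuotient_mul hXA) hV₁ hV₂ hD
  refine (matrixDifferenceQuotient_eq_zero_iff hXA _).1 ?_ i j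
  have h0 := mapAdd_matrixDifferenceQuotient_linear (n := n) hXA (M := 0) (by simp)
  rw [map_zero, sub_zero] at h0
  rw [← coeff_mapAdd, map_sub, h0, hV, sub_self, map_zero]

end Formal

/-! ## Power series expansions of functions of a real variable -/

section Expansion

open Filter Topology

variable {M N E : Type*} [NormedRing M] [NormedAlgebra ℝ M] [NormedRing N] [NormedAlgebra ℝ N]
  [NormedAddCommGroup E] [NormedSpace ℝ E]

/-- Near `0`, the function `f` is the sum of the absolutely convergent series `∑ zᵏ pₖ`. -/
def HasExpansion (f : ℝ → M) (p : PowerSeries M) : Prop :=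
  ∀ᶠ z in 𝓝 (0 : ℝ), Summable (fun k => ‖z ^ k • PowerSeries.coeff k p‖) ∧
    HasSum (fun k => z ^ k • PowerSeries.coeff k p) (f z)

namespace HasExpansion

theorem of_analyticAt {f : ℝ → M} (hf : AnalyticAt ℝ f 0) :
    ∃ p : PowerSeries M, HasExpansion f p := by
  obtain ⟨q, r, hq⟩ := hf
  refine ⟨PowerSeries.mk q.coeff, ?_⟩
  filter_upwards [Metric.eball_mem_nhds (0 : ℝ) hq.r_pos] with z hz
  have h1 := hq.hasSum hz
  have h2 := q.summable_norm_apply (Metric.eball_subset_eball hq.r_le hz)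
  simp only [FormalMultilinearSeries.apply_eq_pow_smul_coeff, zero_add] at h1 h2
  simpa using ⟨h2, h1⟩

theorem unique {f : ℝ → M} {p q : PowerSeries M} (hp : HasExpansion f p)
    (hq : HasExpansion f q) : p = q := by
  let P (p : PowerSeries M) : FormalMultilinearSeries ℝ ℝ M := fun k =>
    ContinuousMultilinearMap.mkPiRing ℝ (Fin k) (PowerSeries.coeff k p)
  have hP : ∀ p k, (P p).coeff k = PowerSeries.coeff k p := fun p k => by
    change ContinuousMultilinearMap.mkPiRing ℝ (Fin k) (PowerSeries.coeff k p) 1 = _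
    rw [ContinuousMultilinearMap.mkPiRing_apply]
    simp
  have key : ∀ p : PowerSeries M, HasExpansion f p → HasFPowerSeriesAt f (P p) 0 := by
    intro p hp
    refine hasFPowerSeriesAt_iff.2 ?_
    filter_upwards [hp] with z hz
    simpa only [hP, zero_add] using hz.2
  have h := (key p hp).eq_formalMultilinearSeries (key q hq)
  ext k
  rw [← hP, h, hP]

theorem congr {f g : ℝ → M} {p : PowerSeries M} (hf : HasExpansion f p) (h : f =ᶠ[𝓝 0] g) :
    HasExpansion g p := by
  filter_upwards [hf, h] with z hz hfg
  rwa [← hfg]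

/-- The Cauchy product; this is where absolute convergence in `HasExpansion` is used. -/
theorem mul [CompleteSpace M] {f g : ℝ → M} {p q : PowerSeries M} (hf : HasExpansion f p)
    (hg : HasExpansion g q) : HasExpansion (fun z => f z * g z) (p * q) := by
  filter_upwards [hf, hg] with z ⟨hf1, hf2⟩ ⟨hg1, hg2⟩
  have hterm : ∀ k, z ^ k • PowerSeries.coeff k (p * q) =
      ∑ x ∈ Finset.HasAntidiagonal.antidiagonal k,
        (z ^ x.1 • PowerSeries.coeff x.1 p) * (z ^ x.2 • PowerSeries.coeff x.2 q) := by
    intro k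
    rw [PowerSeries.coeff_mul, Finset.smul_sum]
    refine Finset.sum_congr rfl fun x hx => ?_
    rw [smul_mul_smul_comm, ← pow_add, Finset.HasAntidiagonal.mem_antidiagonal.1 hx]
  have hs := summable_norm_sum_mul_antidiagonal_of_summable_norm hf1 hg1
  simp only [hterm]
  refine ⟨hs, ?_⟩
  have := tsum_mul_tsum_eq_tsum_sum_antidiagonal_of_summable_norm hf1 hg1
  rw [hf2.tsum_eq, hg2.tsum_eq] at this
  rw [this]
  exact hs.of_norm.hasSum

theorem sub {f g : ℝ → M} {p q : PowerSeries M} (hf : HasExpansion f p)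
    (hg : HasExpansion g q) : HasExpansion (fun z => f z - g z) (p - q) := by
  filter_upwards [hf, hg] with z ⟨hf1, hf2⟩ ⟨hg1, hg2⟩
  simp only [map_sub, smul_sub]
  exact ⟨(hf1.add hg1).of_nonneg_of_le (fun _ => norm_nonneg _) (fun _ => norm_sub_le _ _),
    hf2.sub hg2⟩

theorem map {f : ℝ → M} {p : PowerSeries M} (hf : HasExpansion f p) (φ : M →L[ℝ] N) :
    HasExpansion (fun z => φ (f z))
      (PowerSeries.mapAdd ((φ : M →ₗ[ℝ] N) : M →+ N) p) := by
  filter_upwards [hf] with z ⟨hf1, hf2⟩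
  have hterm : ∀ k, z ^ k • PowerSeries.coeff k
      (PowerSeries.mapAdd ((φ : M →ₗ[ℝ] N) : M →+ N) p) =
        φ (z ^ k • PowerSeries.coeff k p) := by
    intro k
    simp
  simp only [hterm]
  exact ⟨(hf1.mul_left ‖φ‖).of_nonneg_of_le (fun _ => norm_nonneg _)
    (fun _ => φ.le_opNorm _), φ.hasSum hf2⟩

theorem const (a : M) : HasExpansion (fun _ => a) (PowerSeries.C a) := by
  refine Eventually.of_forall fun z => ?_
  have h : ∀ k ≠ 0, z ^ k • PowerSeries.coeff k (PowerSeries.C a) = 0 := fun k hk => by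
    simp [PowerSeries.coeff_C, hk]
  refine ⟨(hasSum_single 0 fun k hk => by simp [h k hk]).summable, ?_⟩
  simpa using hasSum_single 0 h

theorem smul_const (a : M) :
    HasExpansion (fun z => z • a) (PowerSeries.X * PowerSeries.C a) := by
  refine Eventually.of_forall fun z => ?_
  have h : ∀ k ≠ 1, z ^ k • PowerSeries.coeff k (PowerSeries.X * PowerSeries.C a) = 0 := by
    intro k hk
    match k with
    | 0 => simp
    | 1 => exact absurd rfl hk
    | k + 2 =>
      rw [PowerSeries.coeff_succ_X_mul]
      simp
  refine ⟨(hasSum_single 1 fun k hk => by rw [h k hk, norm_zero]).summable, ?_⟩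
  have h1 := hasSum_single 1 h
  rw [PowerSeries.coeff_succ_X_mul (n := 0)] at h1
  simpa using h1

/-- The Taylor series of `g` is a right inverse of `p` by uniqueness of expansions, and `q` is a
left inverse, so they agree. No convergence estimate for `q` is needed. -/
theorem inverse [CompleteSpace M] {f g : ℝ → M} {p q : PowerSeries M} (hf : HasExpansion f p)
    (hg : AnalyticAt ℝ g 0) (hfg : ∀ᶠ z in 𝓝 0, f z * g z = 1) (hqp : q * p = 1) :
    HasExpansion g q := by
  obtain ⟨c, hc⟩ := of_analyticAt hg
  have h1 : p * c = 1 := by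
    refine ((hf.mul hc).congr hfg).unique ?_
    simpa using const (1 : M)
  rwa [left_inv_eq_right_inv hqp h1]

end HasExpansion

/-- An analytic function on the line with values in a closed subspace near `0` has all its values
in that subspace. -/
theorem AnalyticOnNhd.mem_of_eventually_mem {f : ℝ → E} (hf : AnalyticOnNhd ℝ f Set.univ)
    (S : Submodule ℝ E) (hS : IsClosed (S : Set E)) (h : ∀ᶠ z in 𝓝 0, f z ∈ S) (z : ℝ) :
    f z ∈ S := by
  have := hS
  -- Pass to the quotient `E ⧸ S`, normed because `S` is closed, where the function vanishes near
  -- `0`.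
  have h1 : AnalyticOnNhd ℝ (fun z => S.mkQL (f z)) Set.univ := fun z hz =>
    (S.mkQL.analyticAt _).comp (hf z hz)
  have h2 : (fun z => S.mkQL (f z)) = fun _ => 0 :=
    h1.eq_of_eventuallyEq (z₀ := 0) (fun _ _ => analyticAt_const) (by
      filter_upwards [h] with z hz
      simpa using hz)
  simpa using congrFun h2 z

end Expansion

/-- A function into a normed space is differentiable on an open set if its composition with a
linear isometry with closed range is. -/
theorem LinearIsometry.differentiableOn_of_comp {𝕜 E F G : Type*} [NontriviallyNormedField 𝕜]
    [NormedAddCommGroup E] [NormedSpace 𝕜 E] [NormedAddCommGroup F] [NormedSpace 𝕜 F]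
    [NormedAddCommGroup G] [NormedSpace 𝕜 G] (ι : F →ₗᵢ[𝕜] G)
    (hι : IsClosed (Set.range ι)) {f : E → F} {s : Set E} (hs : IsOpen s)
    (hf : DifferentiableOn 𝕜 (fun x => ι (f x)) s) : DifferentiableOn 𝕜 f s := by
  intro x hx
  have hx' := hs.mem_nhds hx
  obtain ⟨D, hD⟩ := hf.differentiableAt hx'
  have hcl : IsClosed (ι.range : Set G) := hι
  -- The quotient map by the closed range kills `ι ∘ f`, hence also its derivative.
  have hmem : ∀ v, D v ∈ ι.range := by
    intro v
    have h1 : HasFDerivAt (fun y => ι.range.mkQL (ι (f y))) (ι.range.mkQL ∘L D) x :=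
      ι.range.mkQL.hasFDerivAt.comp x hD
    have h2 : (fun y => ι.range.mkQL (ι (f y))) = fun _ => 0 := by
      funext y
      simp
    rw [h2] at h1
    have h3 := congrArg (fun T => T v) (h1.unique (hasFDerivAt_const 0 x))
    simpa using h3
  choose T hT using fun v => hmem v
  have hT' : ∀ v, ι (T v) = D v := hT
  let D₀ : E →ₗ[𝕜] F :=
    { toFun := T
      map_add' := fun v w => ι.injective (by rw [hT', map_add, map_add, hT', hT'])
      map_smul' := fun c v => ι.injective (by
        rw [hT', RingHom.id_apply, map_smul, map_smul, hT']) }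
  have hD₀ : ∀ v, ι (D₀ v) = D v := hT
  let D' : E →L[𝕜] F := D₀.mkContinuous ‖D‖ fun v => by
    rw [← ι.norm_map, hD₀]
    exact D.le_opNorm v
  refine (HasFDerivAt.differentiableAt (f' := D') ?_).differentiableWithinAt
  rw [hasFDerivAt_iff_isLittleO] at hD ⊢
  refine (Asymptotics.isLittleO_norm_left.1 ?_)
  have : (fun y => ‖f y - f x - D' (y - x)‖) = fun y => ‖ι (f y) - ι (f x) - D (y - x)‖ := by
    funext y
    rw [← ι.norm_map, map_sub, map_sub, show ι (D' (y - x)) = D (y - x) from hD₀ _]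
  rw [this]
  exact hD.norm_left

/-! ## Matrices over C⋆-algebras -/

section CStarMatrixMaps

variable {K : Type u} {L : Type v} [CStarAlgebra K] [CStarAlgebra L]

/-- The inclusion `M_n(A) → M_n(K)`. -/
def cstarMatrixIncl (n : ℕ) (A : StarSubalgebra ℂ K) :
    CStarMatrix (Fin n) (Fin n) A →⋆ₐ[ℂ] CStarMatrix (Fin n) (Fin n) K where
  toFun M := M.map Subtype.val
  map_one' := by
    ext i j
    by_cases h : i = j <;> simp [CStarMatrix.one_apply, h]
  map_mul' M N := by
    ext i j
    simp [CStarMatrix.mul_apply]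
  map_zero' := by ext; simp
  map_add' M N := by ext; simp
  commutes' r := by
    ext i j
    by_cases h : i = j <;> simp [CStarMatrix.algebraMap_apply, h]
  map_star' M := by ext; simp [CStarMatrix.star_apply]

theorem cstarMatrixIncl_apply {n : ℕ} {A : StarSubalgebra ℂ K}
    (M : CStarMatrix (Fin n) (Fin n) A) : cstarMatrixIncl n A M = M.map Subtype.val := rfl

theorem cstarMatrixIncl_injective (n : ℕ) (A : StarSubalgebra ℂ K) :
    Function.Injective (cstarMatrixIncl n A) :=
  CStarMatrix.map_injective Subtype.val_injective

theorem isSelfAdjoint_tensorOne {X : K} (hX : IsSelfAdjoint X) (n : ℕ) :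
    IsSelfAdjoint (tensorOne X n) := by
  ext i j
  simp only [tensorOne, CStarMatrix.star_apply, CStarMatrix.ofMatrix_apply, Matrix.diagonal_apply]
  by_cases h : i = j
  · simp [h, hX.star_eq]
  · simp [h, Ne.symm h]

/-- `M_n(A⟨X⟩) → M_n(K)`. -/
def polyMatrixVal (n : ℕ) (A : StarSubalgebra ℂ K) (X : K) :
    Matrix (Fin n) (Fin n) (polyAlgebra A X) →+* CStarMatrix (Fin n) (Fin n) K :=
  (CStarMatrix.ofMatrixRingEquiv : Matrix (Fin n) (Fin n) K ≃+* _).toRingHom.comp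
    (polyAlgebra A X).val.toRingHom.mapMatrix

theorem polyMatrixVal_apply {n : ℕ} {A : StarSubalgebra ℂ K} {X : K}
    (M : Matrix (Fin n) (Fin n) (polyAlgebra A X)) (i j : Fin n) :
    polyMatrixVal n A X M i j = M i j := rfl

theorem polyMatrixVal_diagonal_gen {n : ℕ} {A : StarSubalgebra ℂ K} {X : K} :
    polyMatrixVal n A X (Matrix.diagonal fun _ => polyGen A X) = tensorOne X n := by
  ext i j
  rw [polyMatrixVal_apply]
  by_cases h : i = j <;> simp [tensorOne, h, polyGen]

/-- `M_n(A) → M_n(A⟨X⟩)`. -/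
def polyMatrixCoeff (n : ℕ) (A : StarSubalgebra ℂ K) (X : K) :
    CStarMatrix (Fin n) (Fin n) A →+* Matrix (Fin n) (Fin n) (polyAlgebra A X) :=
  (polyCoeff A X).toRingHom.mapMatrix.comp
    (CStarMatrix.ofMatrixRingEquiv : Matrix (Fin n) (Fin n) A ≃+* _).symm.toRingHom

variable [PartialOrder K] [StarOrderedRing K] [PartialOrder L] [StarOrderedRing L]

/-- The inclusion `M_n(A) → M_n(K)` as an isometry. -/
noncomputable def cstarMatrixInclₗᵢ (n : ℕ) (A : StarSubalgebra ℂ K) [IsClosed (A : Set K)] :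
    CStarMatrix (Fin n) (Fin n) A →ₗᵢ[ℂ] CStarMatrix (Fin n) (Fin n) K where
  toLinearMap := (cstarMatrixIncl n A).toAlgHom.toLinearMap
  norm_map' M := NonUnitalStarAlgHom.norm_map (cstarMatrixIncl n A)
    (cstarMatrixIncl_injective n A) M

/-- A completely positive map applied entrywise. -/
noncomputable def CompletelyPositiveMap.mapCStarMatrix (Ψ : L →CP K) (n : ℕ) :
    CStarMatrix (Fin n) (Fin n) L →ₚ[ℂ] CStarMatrix (Fin n) (Fin n) K :=
  PositiveLinearMap.mk₀ (CStarMatrix.mapₗ Ψ.toLinearMap) fun M hM =>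
    Ψ.map_cstarMatrix_nonneg M hM

theorem CompletelyPositiveMap.mapCStarMatrix_apply (Ψ : L →CP K) {n : ℕ}
    (M : CStarMatrix (Fin n) (Fin n) L) : Ψ.mapCStarMatrix n M = M.map Ψ := rfl

theorem CompletelyPositiveMap.mapCStarMatrix_one (Ψ : L →CP K) (hΨ : Ψ 1 = 1) (n : ℕ) :
    Ψ.mapCStarMatrix n 1 = 1 := by
  ext i j
  by_cases h : i = j <;> simp [CompletelyPositiveMap.mapCStarMatrix_apply,
    CStarMatrix.one_apply, h, hΨ]

/-- A completely positive map applied entrywise, as a continuous linear map. -/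
noncomputable def CompletelyPositiveMap.mapCStarMatrixL (Ψ : L →CP K) (n : ℕ) :
    CStarMatrix (Fin n) (Fin n) L →L[ℂ] CStarMatrix (Fin n) (Fin n) K where
  toLinearMap := CStarMatrix.mapₗ Ψ.toLinearMap
  -- Positive maps between C⋆-algebras are automatically continuous.
  cont := map_continuous (Ψ.mapCStarMatrix n)

/-- An entry of a matrix, as a continuous linear function of the matrix. -/
def CStarMatrix.entryL {n : ℕ} (i j : Fin n) : CStarMatrix (Fin n) (Fin n) K →L[ℂ] K where
  toFun M := M i j
  map_add' _ _ := rfl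
  map_smul' _ _ := rfl
  cont := (continuous_apply j).comp (continuous_apply i)

end CStarMatrixMaps

/-! ### Resolvents at points of the half-plane -/

section Resolvent

variable {M : Type*} [CStarAlgebra M] [PartialOrder M] [StarOrderedRing M]

theorem inverse_mem_upperHalfPlane {T : M} (hT : -T ∈ upperHalfPlane M) :
    IsUnit T ∧ Ring.inverse T ∈ upperHalfPlane M := by
  have h := neg_inverse_mem_upperHalfPlane hT
  obtain ⟨t, ht⟩ := isUnit_of_mem_upperHalfPlane hT
  have ht' : T = ((-t : Mˣ) : M) := by simp [ht]
  rw [← ht, Ring.inverse_unit] at h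
  rw [ht', Ring.inverse_unit]
  exact ⟨(-t).isUnit, by simpa using h⟩

/-- The resolvent of a selfadjoint element at a point of the half-plane. -/
theorem resolvent_mem_upperHalfPlane {a T : M} (ha : IsSelfAdjoint a)
    (hT : T ∈ upperHalfPlane M) :
    IsUnit (a - T) ∧ Ring.inverse (a - T) ∈ upperHalfPlane M :=
  inverse_mem_upperHalfPlane (by rw [neg_sub]; exact sub_mem_upperHalfPlane hT ha)

end Resolvent

/-! ## Pushing resolvents forward -/

section Pushforward

open Filter Topology

variable {K : Type u} {L : Type v} [CStarAlgebra K] [PartialOrder K] [StarOrderedRing K]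
  [CStarAlgebra L] [PartialOrder L] [StarOrderedRing L]

theorem map_resolvent_mem_upperHalfPlane {Ψ : L →CP K} (hΨ : Ψ 1 = 1)
    {B : StarSubalgebra ℂ L} [IsClosed (B : Set L)] {n : ℕ}
    {a : CStarMatrix (Fin n) (Fin n) L} (ha : IsSelfAdjoint a)
    {β : CStarMatrix (Fin n) (Fin n) B}
    (hβ : β ∈ upperHalfPlane (CStarMatrix (Fin n) (Fin n) B)) :
    IsUnit (a - cstarMatrixIncl n B β) ∧
      Ψ.mapCStarMatrix n (Ring.inverse (a - cstarMatrixIncl n B β)) ∈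
        upperHalfPlane (CStarMatrix (Fin n) (Fin n) K) := by
  have h := resolvent_mem_upperHalfPlane ha
    (map_mem_upperHalfPlane (cstarMatrixIncl n B) (map_one _) hβ)
  exact ⟨h.1, map_mem_upperHalfPlane _ (Ψ.mapCStarMatrix_one hΨ n) h.2⟩

/-- The image under `M_n(Ψ)` of `-β⁻¹` is invertible over `A`. -/
theorem isUnit_matrixRestrict_inverse {A : StarSubalgebra ℂ K} [IsClosed (A : Set K)]
    {B : StarSubalgebra ℂ L} [IsClosed (B : Set L)] {X : K} {Y : L}
    {Ψ : L →CP K} (hΨ_one : Ψ 1 = 1)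
    (hΨ_maps : ∀ p ∈ polyAlgebra B Y, Ψ.toLinearMap p ∈ polyAlgebra A X)
    (hΨ_coeff : ∀ b ∈ B, Ψ b ∈ A) {n : ℕ} {β : CStarMatrix (Fin n) (Fin n) B}
    (hβ : β ∈ upperHalfPlane (CStarMatrix (Fin n) (Fin n) B)) :
    IsUnit (matrixRestrict n Ψ.toLinearMap hΨ_maps
      (polyMatrixCoeff n B Y (-Ring.inverse β))) := by
  -- Invertibility in `M_n(K)` would not suffice: the inverse must have entries in `A⟨X⟩`. So the
  -- image is regarded as a point of the half-plane of `M_n(A)`.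
  let a : CStarMatrix (Fin n) (Fin n) A :=
    CStarMatrix.ofMatrix fun i j => ⟨Ψ ((-Ring.inverse β) i j), hΨ_coeff _ (Subtype.prop _)⟩
  have ha_incl : cstarMatrixIncl n A a =
      Ψ.mapCStarMatrix n (cstarMatrixIncl n B (-Ring.inverse β)) := by
    ext i j
    rfl
  have ha : a ∈ upperHalfPlane (CStarMatrix (Fin n) (Fin n) A) := by
    refine mem_upperHalfPlane_of_map (cstarMatrixIncl n A) (cstarMatrixIncl_injective n A) ?_
    rw [ha_incl]
    exact map_mem_upperHalfPlane (Ψ.mapCStarMatrix n) (Ψ.mapCStarMatrix_one hΨ_one n)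
      (map_mem_upperHalfPlane (cstarMatrixIncl n B) (map_one _)
        (neg_inverse_mem_upperHalfPlane hβ))
  have ha_coeff : matrixRestrict n Ψ.toLinearMap hΨ_maps
      (polyMatrixCoeff n B Y (-Ring.inverse β)) = polyMatrixCoeff n A X a := by
    ext i j
    rfl
  rw [ha_coeff]
  exact (isUnit_of_mem_upperHalfPlane ha).map (polyMatrixCoeff n A X)

theorem analyticAt_linear_sub {M : Type*} [NormedRing M] [NormedAlgebra ℝ M] (a b : M) (z : ℝ) :
    AnalyticAt ℝ (fun z : ℝ => z • a - b) z :=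
  (analyticAt_id.smul analyticAt_const).sub analyticAt_const

theorem AnalyticAt.ringInverse {M : Type*} [NormedRing M] [NormedAlgebra ℝ M] [CompleteSpace M]
    {f : ℝ → M} {z : ℝ} (hf : AnalyticAt ℝ f z) (hu : IsUnit (f z)) :
    AnalyticAt ℝ (fun z => Ring.inverse (f z)) z := by
  obtain ⟨u, hu⟩ := hu
  exact AnalyticAt.comp (hu ▸ analyticAt_inverse u) hf

theorem DifferentiableAt.ringInverse {E M : Type*} [NormedAddCommGroup E] [NormedSpace ℂ E]
    [NormedRing M] [NormedAlgebra ℂ M] [CompleteSpace M] {f : E → M} {x : E}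
    (hf : DifferentiableAt ℂ f x) (hu : IsUnit (f x)) :
    DifferentiableAt ℂ (fun x => Ring.inverse (f x)) x := by
  obtain ⟨u, hu⟩ := hu
  have h : DifferentiableAt ℂ Ring.inverse (f x) :=
    hu ▸ (analyticAt_inverse (𝕜 := ℂ) u).differentiableAt
  exact h.comp x hf

open PowerSeries in
/-- Let `W` be the formal resolvent `(t y - b)⁻¹` and `V` the formal inverse of its image under
`φ`. If `φ` lifts to a continuous linear map `Φ`, and the coefficients of `t x - V` lie in a closed
subspace, then so does the value at `t = 1` of the corresponding analytic function. -/
theorem apply_sub_inverse_mem_of_coeff_mem {R S M N E : Type*} [Ring R] [Ring S]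
    [NormedRing M] [NormedAlgebra ℂ M] [CompleteSpace M]
    [NormedRing N] [NormedAlgebra ℂ N] [CompleteSpace N] [NormedAddCommGroup E] [NormedSpace ℂ E]
    (f : R →+* M) (g : S →+* N) (φ : R →+ S) (Φ : M →L[ℂ] N) (hΦ : ∀ a, g (φ a) = Φ (f a))
    {y b : R} {x : S} (hunit : ∀ z : ℝ, IsUnit ((z : ℂ) • f y - f b) ∧
      IsUnit (Φ (Ring.inverse ((z : ℂ) • f y - f b))))
    {W : PowerSeries R} (hW : W * (PowerSeries.X * C y - C b) = 1)
    {V : PowerSeries S} (hV : V * mapAdd φ W = 1)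
    (ℓ : N →L[ℂ] E) (Q : Submodule ℂ E) (hQ : IsClosed (Q : Set E))
    (hmem : ∀ k, ℓ (g (coeff k (PowerSeries.X * C x - V))) ∈ Q) :
    ℓ (g x - Ring.inverse (Φ (Ring.inverse (f y - f b)))) ∈ Q := by
  simp only [Complex.coe_smul] at hunit
  let r : ℝ → M := fun z => Ring.inverse (z • f y - f b)
  let v : ℝ → N := fun z => Ring.inverse (Φ (r z))
  have hr : ∀ z, AnalyticAt ℝ r z := fun z =>
    (analyticAt_linear_sub _ _ z).ringInverse (hunit z).1
  have hv : ∀ z, AnalyticAt ℝ v z := fun z =>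
    ((((Φ.restrictScalars ℝ).analyticAt _).comp (hr z)) :
      AnalyticAt ℝ (fun z => Φ (r z)) z).ringInverse (hunit z).2
  have hlin : HasExpansion (fun z : ℝ => z • f y - f b)
      (PowerSeries.map f (PowerSeries.X * C y - C b)) := by
    simpa using (HasExpansion.smul_const (f y)).sub (HasExpansion.const (f b))
  have hrexp : HasExpansion r (PowerSeries.map f W) :=
    hlin.inverse (hr 0) (Eventually.of_forall fun z => Ring.mul_inverse_cancel _ (hunit z).1)
      (by rw [← map_mul, hW, map_one])
  have hwexp : HasExpansion (fun z => Φ (r z)) (PowerSeries.map g (mapAdd φ W)) := by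
    have heq : PowerSeries.map g (mapAdd φ W) =
        mapAdd (((Φ.restrictScalars ℝ : M →L[ℝ] N) : M →ₗ[ℝ] N) : M →+ N)
          (PowerSeries.map f W) := by
      ext k
      simp [hΦ]
    rw [heq]
    exact hrexp.map (Φ.restrictScalars ℝ)
  have hvexp : HasExpansion v (PowerSeries.map g V) :=
    hwexp.inverse (hv 0) (Eventually.of_forall fun z => Ring.mul_inverse_cancel _ (hunit z).2)
      (by rw [← map_mul, hV, map_one])
  have hGexp : HasExpansion (fun z : ℝ => z • g x - v z)
      (PowerSeries.map g (PowerSeries.X * C x - V)) := by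
    simpa using (HasExpansion.smul_const (g x)).sub hvexp
  have han : AnalyticOnNhd ℝ (fun z : ℝ => ℓ.restrictScalars ℝ (z • g x - v z)) Set.univ :=
    fun z _ => ((ℓ.restrictScalars ℝ).analyticAt _).comp
      ((analyticAt_id.smul analyticAt_const).sub (hv z))
  have h0 : ∀ᶠ z in 𝓝 (0 : ℝ),
      ℓ.restrictScalars ℝ (z • g x - v z) ∈ Q.restrictScalars ℝ := by
    filter_upwards [hGexp] with z hz
    -- The partial sums lie in `Q`, and `Q` is closed.
    refine hQ.mem_of_tendsto ((ℓ.restrictScalars ℝ).hasSum hz.2)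
      (Eventually.of_forall fun s => ?_)
    refine (Q.restrictScalars ℝ).sum_mem fun k _ => ?_
    rw [map_smul, coeff_map]
    exact (Q.restrictScalars ℝ).smul_mem _ (hmem k)
  have h1 := han.mem_of_eventually_mem (Q.restrictScalars ℝ) hQ h0 1
  simpa [v, r] using h1

open PowerSeries in
/-- The subordination point: `X - M_n(Ψ)((Y - β)⁻¹)⁻¹` has its entries in `A`. -/
theorem exists_incl_eq_sub_inverse
    {A : StarSubalgebra ℂ K} [IsClosed (A : Set K)] {B : StarSubalgebra ℂ L} [IsClosed (B : Set L)]
    {X : K} (hXA : AlgebraicallyFree A X) {Y : L} (hY : IsSelfAdjoint Y)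
    (hYB : AlgebraicallyFree B Y) (Ψ : L →CP K) (hΨ_one : Ψ 1 = 1)
    (hΨ_maps : ∀ p ∈ polyAlgebra B Y, Ψ.toLinearMap p ∈ polyAlgebra A X)
    (hΨ_comul : ∀ p : polyAlgebra B Y,
      TensorProduct.map Ψ.toLinearMap Ψ.toLinearMap (freeDifferenceQuotientIn hYB p) =
        freeDifferenceQuotientIn hXA ⟨Ψ.toLinearMap p, hΨ_maps p p.2⟩) {n : ℕ}
    {β : CStarMatrix (Fin n) (Fin n) B}
    (hβ : β ∈ upperHalfPlane (CStarMatrix (Fin n) (Fin n) B)) :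
    ∃ α : CStarMatrix (Fin n) (Fin n) A, cstarMatrixIncl n A α = tensorOne X n -
      Ring.inverse (Ψ.mapCStarMatrix n (Ring.inverse (tensorOne Y n - cstarMatrixIncl n B β))) := by
  have hunits : ∀ z : ℝ, IsUnit ((z : ℂ) • tensorOne Y n - cstarMatrixIncl n B β) ∧
      IsUnit (Ψ.mapCStarMatrix n
        (Ring.inverse ((z : ℂ) • tensorOne Y n - cstarMatrixIncl n B β))) := by
    intro z
    have hz : IsSelfAdjoint (z : ℂ) := Complex.conj_ofReal z
    have h := map_resolvent_mem_upperHalfPlane hΨ_one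
      (hz.smul (isSelfAdjoint_tensorOne hY n)) hβ
    exact ⟨h.1, isUnit_of_mem_upperHalfPlane h.2⟩
  -- the formal resolvent of `Y`
  let b : Matrix (Fin n) (Fin n) (polyAlgebra B Y) := polyMatrixCoeff n B Y β
  have hβu := isUnit_of_mem_upperHalfPlane hβ
  have hbinv : b * polyMatrixCoeff n B Y (Ring.inverse β) = 1 := by
    rw [← map_mul, Ring.mul_inverse_cancel _ hβu, map_one]
  have hbinv' : polyMatrixCoeff n B Y (Ring.inverse β) * b = 1 := by
    rw [← map_mul, Ring.inverse_mul_cancel _ hβu, map_one]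
  -- The constant term `-β` of `tY - β`, as a unit over `B⟨Y⟩`.
  let u : (Matrix (Fin n) (Fin n) (polyAlgebra B Y))ˣ :=
    ⟨-b, polyMatrixCoeff n B Y (-Ring.inverse β), by rw [map_neg, neg_mul_neg, hbinv],
      by rw [map_neg, neg_mul_neg, hbinv']⟩
  let P : PowerSeries (Matrix (Fin n) (Fin n) (polyAlgebra B Y)) :=
    PowerSeries.X * C (Matrix.diagonal fun _ => polyGen B Y) - C b
  have hPu : constantCoeff P = u := by simp [P, u]
  let W := invOfUnit P u
  have hW₁ : P * W = 1 := mul_invOfUnit P u hPu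
  have hW₂ : W * P = 1 := invOfUnit_mul P u hPu
  -- the formal inverse of its image
  have hWu : IsUnit (constantCoeff (mapAdd (matrixRestrict n Ψ.toLinearMap hΨ_maps) W)) := by
    rw [← coeff_zero_eq_constantCoeff_apply, coeff_mapAdd, coeff_zero_eq_constantCoeff_apply,
      constantCoeff_invOfUnit]
    exact isUnit_matrixRestrict_inverse hΨ_one hΨ_maps
      (fun _ hb => map_coeff_mem hXA hYB Ψ.toLinearMap hΨ_maps hΨ_comul hb) hβ
  obtain ⟨u', hu'⟩ := hWu
  let V := invOfUnit (mapAdd (matrixRestrict n Ψ.toLinearMap hΨ_maps) W) u'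
  have hV₁ : mapAdd (matrixRestrict n Ψ.toLinearMap hΨ_maps) W * V = 1 :=
    mul_invOfUnit _ u' hu'.symm
  have hV₂ : V * mapAdd (matrixRestrict n Ψ.toLinearMap hΨ_maps) W = 1 :=
    invOfUnit_mul _ u' hu'.symm
  have hmem := coeff_linear_sub_inverse_mem hXA hYB Ψ.toLinearMap hΨ_maps hΨ_comul
    (β := b) (fun i j => (β i j).2) hW₁ hW₂ hV₁ hV₂
  have hA : ∀ i j, (tensorOne X n - Ring.inverse (Ψ.mapCStarMatrix n
      (Ring.inverse (tensorOne Y n - cstarMatrixIncl n B β)))) i j ∈ A := by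
    intro i j
    have h := apply_sub_inverse_mem_of_coeff_mem (polyMatrixVal n B Y) (polyMatrixVal n A X)
      (matrixRestrict n Ψ.toLinearMap hΨ_maps) (Ψ.mapCStarMatrixL n) (fun a => by ext i j; rfl)
      (y := Matrix.diagonal fun _ => polyGen B Y) (b := b)
      (x := Matrix.diagonal fun _ => polyGen A X)
      (by simpa only [polyMatrixVal_diagonal_gen] using! hunits) hW₂ hV₂ (CStarMatrix.entryL i j)
      (Subalgebra.toSubmodule A.toSubalgebra) ‹IsClosed (A : Set K)› (fun k => hmem k i j)
    rw [polyMatrixVal_diagonal_gen, polyMatrixVal_diagonal_gen] at h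
    exact h
  exact ⟨CStarMatrix.ofMatrix fun i j => ⟨_, hA i j⟩, rfl⟩

/-- The pushforward is holomorphic. -/
theorem differentiableOn_sub_inverse {B : StarSubalgebra ℂ L} [IsClosed (B : Set L)]
    {Y : L} (hY : IsSelfAdjoint Y) (Ψ : L →CP K) (hΨ_one : Ψ 1 = 1) (n : ℕ)
    (x : CStarMatrix (Fin n) (Fin n) K) :
    DifferentiableOn ℂ (fun β : CStarMatrix (Fin n) (Fin n) B => x -
      Ring.inverse (Ψ.mapCStarMatrix n (Ring.inverse (tensorOne Y n - cstarMatrixIncl n B β))))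
      (upperHalfPlane (CStarMatrix (Fin n) (Fin n) B)) := by
  intro β hβ
  have h := map_resolvent_mem_upperHalfPlane hΨ_one (isSelfAdjoint_tensorOne hY n) hβ
  have h1 : DifferentiableAt ℂ (fun β : CStarMatrix (Fin n) (Fin n) B =>
      tensorOne Y n - cstarMatrixIncl n B β) β :=
    (differentiableAt_const _).sub
      (cstarMatrixInclₗᵢ n B).toContinuousLinearMap.differentiableAt
  have h2 : DifferentiableAt ℂ (fun β : CStarMatrix (Fin n) (Fin n) B =>
      Ring.inverse (tensorOne Y n - cstarMatrixIncl n B β)) β :=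
    h1.ringInverse h.1
  have h3 : DifferentiableAt ℂ (fun β : CStarMatrix (Fin n) (Fin n) B =>
      Ψ.mapCStarMatrix n (Ring.inverse (tensorOne Y n - cstarMatrixIncl n B β))) β :=
    (Ψ.mapCStarMatrixL n).differentiableAt.comp β h2
  have h4 : DifferentiableAt ℂ (fun β : CStarMatrix (Fin n) (Fin n) B => Ring.inverse
      (Ψ.mapCStarMatrix n (Ring.inverse (tensorOne Y n - cstarMatrixIncl n B β)))) β :=
    h3.ringInverse (isUnit_of_mem_upperHalfPlane h.2)
  exact ((differentiableAt_const _).sub h4).differentiableWithinAt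

end Pushforward

/-! ### Assembly of the subordination map -/

theorem mainTheorem2 {K : Type u} {L : Type v}
    [CStarAlgebra K] [PartialOrder K] [StarOrderedRing K]
    [CStarAlgebra L] [PartialOrder L] [StarOrderedRing L]
    (A : StarSubalgebra ℂ K) [IsClosed (A : Set K)]
    (B : StarSubalgebra ℂ L) [IsClosed (B : Set L)]
    (X : K) (hX : IsSelfAdjoint X) (hXA : AlgebraicallyFree A X)
    (Y : L) (hY : IsSelfAdjoint Y) (hYB : AlgebraicallyFree B Y)
    (Ψ : L →CP K) (hΨ_one : Ψ 1 = 1)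
    (hΨ_maps : ∀ p ∈ polyAlgebra B Y, Ψ p ∈ polyAlgebra A X)
    (hΨ_comul : ∀ p : polyAlgebra B Y,
      TensorProduct.map Ψ.toLinearMap Ψ.toLinearMap (freeDifferenceQuotientIn hYB p) =
        freeDifferenceQuotientIn hXA ⟨Ψ p, hΨ_maps p p.2⟩)
    (hX_closable : (freeDifferenceQuotientOp hXA).IsClosable)
    (hY_closable : (freeDifferenceQuotientOp hYB).IsClosable)
    (n : ℕ) :
    ∃ F : CStarMatrix (Fin n) (Fin n) B → CStarMatrix (Fin n) (Fin n) A,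
      DifferentiableOn ℂ F (upperHalfPlane (CStarMatrix (Fin n) (Fin n) B)) ∧
      Set.MapsTo F (upperHalfPlane (CStarMatrix (Fin n) (Fin n) B))
        (upperHalfPlane (CStarMatrix (Fin n) (Fin n) A)) ∧
      ∀ β ∈ upperHalfPlane (CStarMatrix (Fin n) (Fin n) B),
        IsUnit (tensorOne Y n - β.map Subtype.val) ∧
        IsUnit (tensorOne X n - (F β).map Subtype.val) ∧
        (Ring.inverse (tensorOne Y n - β.map Subtype.val)).map Ψ =
          Ring.inverse (tensorOne X n - (F β).map Subtype.val) := by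
  have hex := fun β (hβ : β ∈ upperHalfPlane (CStarMatrix (Fin n) (Fin n) B)) =>
    exists_incl_eq_sub_inverse hXA hY hYB Ψ hΨ_one hΨ_maps hΨ_comul hβ
  choose! F hF using hex
  have hres := fun β (hβ : β ∈ upperHalfPlane (CStarMatrix (Fin n) (Fin n) B)) =>
    map_resolvent_mem_upperHalfPlane hΨ_one (isSelfAdjoint_tensorOne hY n) hβ
  refine ⟨F, ?_, ?_, ?_⟩
  · refine (cstarMatrixInclₗᵢ n A).differentiableOn_of_comp
      (cstarMatrixInclₗᵢ n A).isometry.isClosedEmbedding.isClosed_range isOpen_upperHalfPlane ?_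
    exact (differentiableOn_sub_inverse hY Ψ hΨ_one n (tensorOne X n)).congr
      fun β hβ => hF β hβ
  · intro β hβ
    refine mem_upperHalfPlane_of_map (cstarMatrixIncl n A) (cstarMatrixIncl_injective n A) ?_
    rw [hF β hβ]
    -- `F(β) = -G(β)⁻¹ - (-X)`, with `-X` selfadjoint.
    have h := sub_mem_upperHalfPlane (neg_inverse_mem_upperHalfPlane (hres β hβ).2)
      (isSelfAdjoint_tensorOne hX n).neg
    rwa [sub_neg_eq_add, neg_add_eq_sub] at h
  · intro β hβ
    obtain ⟨w, hw⟩ := isUnit_of_mem_upperHalfPlane (hres β hβ).2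
    have hFβ : tensorOne X n - (F β).map Subtype.val = ((w⁻¹ : _ˣ) : _) := by
      rw [← cstarMatrixIncl_apply, hF β hβ, sub_sub_cancel, ← hw, Ring.inverse_unit]
    refine ⟨(hres β hβ).1, hFβ ▸ Units.isUnit _, ?_⟩
    rw [hFβ, Ring.inverse_unit, inv_inv, hw]
    rfl
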